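/- Fix $N\in\mathbb N$ (end-effectors), a mass $m>0$, vectors $\mathbf g,\mathbf c_{\rm init},\dot{\mathbf c}_{\rm init},\mathbf k_{\rm init}\in\mathbb R^3$, real numbers $T_{\rm tot},R,K$, positive reals $\mu_f,L_f,\mu_\phi,L_\phi$ and a penalty parameter $\rho\ge 4L_\phi^2/\mu_\phi$. For $T\in\mathbb N$ and $\Delta t>0$ write $x=(x_0,\dots,x_T)$ with blocks $x_i=(\mathbf f_i^1,\dots,\mathbf f_i^N)\in(\mathbb R^3)^N$ and $z=(\mathbf k'_0,\dots,\mathbf k'_T)\in(\mathbb R^3)^{T+1}$, so that $n_x=3N(T+1)$ and $n_z=3(T+1)$. Given contact locations $\mathbf r_i^j\in\mathbb R^3$ ($0\le i<T$, $1\le j\le N$), put $$\mathbf c_i(x)=\mathbf c_{\rm init}+i\,\Delta t\,\dot{\mathbf c}_{\rm init}+\sum_{i'=0}^{i-2}(i-1-i')\Big(\sum_{l=1}^N\frac{\mathbf f_{i'}^l}{m}+\mathbf g\Big)(\Delta t)^2,$$ $$A(x)_0=\mathbf k_{\rm init},\qquad A(x)_{i+1}=\sum_{j=1}^N\big((\mathbf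 r_i^j-\mathbf c_i(x))\times\mathbf f_i^j\big)\Delta t\quad(0\le i<T).$$ The locomotion problem is $$\min_{x,z}\ f(x)+\sum_{i=0}^T I_i(x_i)+\phi(z)\quad\text{s.t. } z=A(x),\qquad(\ast)$$ where $I_i$ is the $\{0,+\infty\}$-valued indicator function of a convex closed set $X_i\subseteq\mathbb R^{3N}$. Its augmented Lagrangian is $$L(x,z,w)=f(x)+\sum_i I_i(x_i)+\phi(z)+\langle w,A(x)-z\rangle+\tfrac\rho2\|A(x)-z\|^2 .$$ ADMM iterates are sequences with, for all $k\ge0$: $x_i^{k+1}\in\arg\min_{x_i}L(x_{0:i-1}^{k+1},x_i,x_{i+1:T}^k,z^k,w^k)$ for $i=0,\dots,T$ in order; $z^{k+1}\in\arg\min_zL(x^{k+1},z,w^k)$; $w^{k+1}=w^k+\rho(A(x^{k+1})-z^{k+1})$. Claim. There is $t_0>0$ such that for every $T\in\mathbb N$ there is $c_3>1$ such that the following holds for every $\Delta t\in(0,t_0]$ with $T\Delta t\le T_{\rm tot}$ (in particular for $\Delta t=T_{\rm tot}/T$). Suppose that - $\|\mathbf r_i^j\|\le R$ for all $i,j$,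 and the sets $X_i$ are convex and closed; - $f$ is $C^2$, $\mu_f$-strongly convex and $L_f$-smooth (its gradient is $L_f$-Lipschitz), and $\phi$ is $C^2$, $\mu_\phi$-strongly convex and $L_\phi$-smooth; - the minimizers $x_f^\star$ of $f$ and $z_\phi^\star$ of $\phi$ satisfy $\|x_f^\star\|^2\le Kn_x$ and $\|z_\phi^\star\|^2\le Kn_z$; - $(x^k,z^k,w^k)_{k\ge0}$ are ADMM iterates with $x^0_i\in X_i$ for all $i$, $\|x^0\|^2\le Kn_x$, $\|z^0\|^2\le Kn_z$ and $\|w^0\|^2\le Kn_z$. Then $L(x^k,z^k,w^k)$ is finite for all $k$, the iterates have at least one limit point, and whenever $L$ is twice differentiable (in particular finite nearby) at a limit point $(x^\star,z^\star,w^\star)$ of the iterates, the iterates converge to $(x^\star,z^\star,w^\star)$, $$L(x^k,z^k,w^k)-L(x^\star,z^\star,w^\star)\in\mathcal O(c_3^{-k}),$$ and $(x^\star,z^\star)$ is a local minimum of the locomotion problem $(\ast)$. -/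

import Mathlib

open Filter Topology Set

noncomputable section

namespace Locomotion

/-- Physical space `ℝ³` with the Euclidean norm. -/
abbrev Vec : Type := EuclideanSpace ℝ (Fin 3)

/-- One block `x_i = (f_i^1, …, f_i^N)`: the contact forces at time index `i`. -/
abbrev Block (N : ℕ) : Type := PiLp 2 (fun _ : Fin N => Vec)

/-- The variable `x = (x_0, …, x_T)`, of dimension `3 N (T + 1)`, with the Euclidean norm. -/
abbrev Forces (N T : ℕ) : Type := PiLp 2 (fun _ : Fin (T + 1) => Block N)

/-- The variable `z = (k'_0, …, k'_T)` (and the dual variable `w`), of dimension `3 (T + 1)`,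
with the Euclidean norm. -/
abbrev Momenta (T : ℕ) : Type := PiLp 2 (fun _ : Fin (T + 1) => Vec)

/-- The exterior (cross) product on `ℝ³`. -/
def cross (a b : Vec) : Vec := WithLp.toLp 2 (crossProduct a.ofLp b.ofLp)

/-- The physical constants of the robot and the initial state of its center of mass. -/
structure RobotData where
  /-- mass `m` -/
  mass : ℝ
  /-- gravity vector `g` -/
  gravity : Vec
  /-- initial position of the center of mass -/
  comInit : Vec
  /-- initial velocity of the center of mass -/
  velInit : Vec
  /-- initial angular momentum -/
  angInit : Vec

/-- Position of the center of mass at time index `i` as a function of the forces: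
`c_i = c_init + i Δt ċ_init + ∑_{i' ≤ i - 2} (i - 1 - i') (∑_l f_{i'}^l / m + g) Δt²`
(the sum is empty for `i = 0, 1`). -/
def comPos {N T : ℕ} (B : RobotData) (Δt : ℝ) (x : Forces N T) (i : ℕ) : Vec :=
  B.comInit + ((i : ℝ) * Δt) • B.velInit +
    ∑ i' : Fin (T + 1) with i'.val + 2 ≤ i,
      (((i : ℝ) - 1 - (i'.val : ℝ)) * Δt ^ 2) • ((∑ l : Fin N, (1 / B.mass) • x i' l) + B.gravity)

/-- The multi-affine quadratic map `A` of the dynamics: `A(x)_0 = k_init` and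
`A(x)_{i+1} = ∑_j ((r_i^j - c_i(x)) × f_i^j) Δt` for `0 ≤ i < T`.
The constraint of the locomotion problem is `z = A(x)`. -/
def momentumMap {N T : ℕ} (B : RobotData) (Δt : ℝ) (r : Fin T → Fin N → Vec)
    (x : Forces N T) : Momenta T :=
  WithLp.toLp 2 (Fin.cases B.angInit (fun i : Fin T =>
    Δt • ∑ j : Fin N, cross (r i j - comPos B Δt x i) (x i.castSucc j)))

open Classical in
/-- The indicator function (in the sense of convex analysis) of a set. -/
def indicatorFn {α : Type*} (S : Set α) (u : α) : EReal := if u ∈ S then 0 else ⊤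

/-- The objective `f(x) + φ(z) + ∑_i I_i(x_i)`. -/
def objective {N T : ℕ} (f : Forces N T → ℝ) (φ : Momenta T → ℝ)
    (X : Fin (T + 1) → Set (Block N)) (x : Forces N T) (z : Momenta T) : EReal :=
  ((f x + φ z : ℝ) : EReal) + ∑ i, indicatorFn (X i) (x i)

/-- The augmented Lagrangian of `min f(x) + ∑_i I_i(x_i) + φ(z)` subject to `A(x) + Q z = 0`
with `Q = -1` and `A = momentumMap`. -/
def augLagrangian {N T : ℕ} (B : RobotData) (Δt : ℝ) (r : Fin T → Fin N → Vec)
    (f : Forces N T → ℝ) (φ : Momenta T → ℝ) (X : Fin (T + 1) → Set (Block N)) (ρ : ℝ)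
    (x : Forces N T) (z w : Momenta T) : EReal :=
  objective f φ X x z +
    ((inner ℝ w (momentumMap B Δt r x - z) + ρ / 2 * ‖momentumMap B Δt r x - z‖ ^ 2 : ℝ) : EReal)

/-- The point `(x⁺_0, …, x⁺_{i-1}, u, x_{i+1}, …, x_T)`. -/
def sweep {N T : ℕ} (xnew xold : Forces N T) (i : Fin (T + 1)) (u : Block N) : Forces N T :=
  WithLp.toLp 2 (fun l => if l < i then xnew l else if l = i then u else xold l)

/-- The sequence `(x^k, z^k, w^k)` is produced by ADMM with penalty parameter `ρ` for the
extended-real-valued augmented Lagrangian `L` and the constraint `A(x) - z = 0`. -/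
structure IsADMM {N T : ℕ} (L : Forces N T → Momenta T → Momenta T → EReal)
    (A : Forces N T → Momenta T) (ρ : ℝ)
    (x : ℕ → Forces N T) (z w : ℕ → Momenta T) : Prop where
  x_step : ∀ k i, IsMinOn (fun u => L (sweep (x (k + 1)) (x k) i u) (z k) (w k)) univ (x (k + 1) i)
  z_step : ∀ k, IsMinOn (fun v => L (x (k + 1)) v (w k)) univ (z (k + 1))
  w_step : ∀ k, w (k + 1) = w k + ρ • (A (x (k + 1)) - z (k + 1))

/-- `g` is `C²`, `μ`-strongly convex and `ℓ`-smooth (its gradient is `ℓ`-Lipschitz). -/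
structure IsSmoothStronglyConvex {E : Type*} [NormedAddCommGroup E] [InnerProductSpace ℝ E]
    [CompleteSpace E] (g : E → ℝ) (μ ℓ : ℝ) : Prop where
  contDiff : ContDiff ℝ 2 g
  strongConvex : StrongConvexOn univ μ g
  smooth : ∀ u v, ‖gradient g u - gradient g v‖ ≤ ℓ * ‖u - v‖

/-- An extended-real-valued function is twice differentiable at `p`: near `p` it is finite and
differentiable, and its derivative is differentiable at `p`. -/
def TwiceDifferentiableAt {E : Type*} [NormedAddCommGroup E] [NormedSpace ℝ E]
    (g : E → EReal) (p : E) : Prop :=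
  ∃ h : E → ℝ, (∀ᶠ q in 𝓝 p, g q = (h q : EReal)) ∧
    (∀ᶠ q in 𝓝 p, DifferentiableAt ℝ h q) ∧ DifferentiableAt ℝ (fderiv ℝ h) p

/-- `(x, z)` is a local minimum of the locomotion problem: it is feasible, with finite objective,
and minimizes the objective among all nearby points satisfying the constraint. -/
def IsLocalMinimum {N T : ℕ} (A : Forces N T → Momenta T) (f : Forces N T → ℝ)
    (φ : Momenta T → ℝ) (X : Fin (T + 1) → Set (Block N))
    (x : Forces N T) (z : Momenta T) : Prop :=
  (∀ i, x i ∈ X i) ∧ z = A x ∧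
    IsLocalMinOn (fun q : Forces N T × Momenta T => objective f φ X q.1 q.2)
      {q | q.2 = A q.1} (x, z)

end Locomotion

end

open Filter Topology Set

set_option linter.unusedSectionVars false

/-! ### First-order inequalities for smooth strongly convex functions -/

namespace Locomotion

/-! The constraint map `A` is quadratic but affine in each block, so every block update is a convex
problem, and strong convexity of `f` makes the Lagrangian drop by at least `μf / 2 * ‖dx‖ ^ 2` over
a sweep. The z-step gains `μφ / 2 * ‖dz‖ ^ 2`, and its optimality condition reads `w = ∇φ(z)`
(`IsBlockADMM.dual_eq`). The dual step therefore costs at most `ρ⁻¹ * Lφ ^ 2 * ‖dz‖ ^ 2 ≤ μφ / 4 *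
‖dz‖ ^ 2`, and the Lagrangian decreases sufficiently from the first iterate on
(`IsBlockADMM.descent`).

Since `w = ∇φ(z)`, the Lagrangian dominates `f + φ ∘ A` (`le_lag`), so the iterates are bounded by
`C * √(T + 1)` with `C` independent of `T` and `Δt` (`exists_iterate_bound`). The bilinear part `b`
of `A` has a bound `q` with `q * √(T + 1) = O(Δt)`, uniformly in `T`, because `T * Δt` is bounded
(`quadratic_coeff_le`). When an iterate is compared with a feasible `y = x + h`, the only nonconvex
contribution is `⟨w, b(h, h)⟩`. For small `Δt` it is at most `μf / 4 * ‖h‖ ^ 2` and is absorbed by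
the strong convexity of `f`. Hence the Lagrangian exceeds the value of any feasible `y`, near or
far, by at most a multiple of the last squared step (`IsBlockADMM.lag_le_value_add`).

With `y` the limit point, sufficient decrease turns this into `gap (k + 1) ≤ θ * (gap k - gap (k +
1))`, a geometric contraction. The squared steps are then geometrically small, the iterates are
Cauchy, and the limit is even a global minimizer (`IsBlockADMM.linear_convergence`). -/

theorem nonneg_of_mul_add_sq_nonneg {a c : ℝ}
    (h : ∀ t : ℝ, 0 < t → t ≤ 1 → 0 ≤ t * a + t ^ 2 * c) : 0 ≤ a := by
  -- Divide by `t` and let `t → 0⁺`. This extracts first-order conditions from minimality along a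
  -- segment.
  have hlim : Tendsto (fun t : ℝ => a + t * c) (𝓝[>] 0) (𝓝 (a + 0 * c)) :=
    ((continuous_const.add (continuous_id.mul continuous_const)).tendsto 0).mono_left
      nhdsWithin_le_nhds
  rw [zero_mul, add_zero] at hlim
  refine ge_of_tendsto hlim ?_
  filter_upwards [Ioc_mem_nhdsGT (zero_lt_one' ℝ)] with t ht
  have h1 := h t ht.1 ht.2
  have h2 : t * a + t ^ 2 * c = t * (a + t * c) := by ring
  rw [h2] at h1
  exact nonneg_of_mul_nonneg_right h1 ht.1

namespace IsSmoothStronglyConvex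

variable {E : Type*} [NormedAddCommGroup E] [InnerProductSpace ℝ E] [CompleteSpace E]
  {g : E → ℝ} {μ ℓ : ℝ}

/-- Strong convexity on the segment from `x` to `x + h`, divided by `t`, in the limit `t → 0⁺`. -/
theorem lower (hg : IsSmoothStronglyConvex g μ ℓ) (x h : E) :
    g x + inner ℝ (gradient g x) h + μ / 2 * ‖h‖ ^ 2 ≤ g (x + h) := by
  have hd : DifferentiableAt ℝ g x := hg.contDiff.differentiable (by norm_num) x
  have h1 : HasDerivAt (fun t : ℝ => x + t • h) h 0 := by
    simpa using ((hasDerivAt_id (0 : ℝ)).smul_const h).const_add x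
  have h2 : HasDerivAt (fun t : ℝ => g (x + t • h)) (inner ℝ (gradient g x) h) 0 := by
    have h3 : HasFDerivAt g (fderiv ℝ g x) (x + (0 : ℝ) • h) := by simpa using hd.hasFDerivAt
    rw [inner_gradient_left]
    exact h3.comp_hasDerivAt (0 : ℝ) h1
  have h4 := h2.tendsto_slope_zero_right
  have h5 : Tendsto (fun t : ℝ => g (x + h) - g x - (1 - t) * (μ / 2 * ‖h‖ ^ 2)) (𝓝[>] 0)
      (𝓝 (g (x + h) - g x - (1 - 0) * (μ / 2 * ‖h‖ ^ 2))) := by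
    refine Tendsto.mono_left (Continuous.tendsto ?_ 0) nhdsWithin_le_nhds
    fun_prop
  have h6 := le_of_tendsto_of_tendsto h4 h5 (by
    filter_upwards [Ioc_mem_nhdsGT (zero_lt_one' ℝ)] with t ht
    have h7 := hg.strongConvex.2 (mem_univ x) (mem_univ (x + h)) (sub_nonneg.2 ht.2) ht.1.le
      (by ring)
    have h8 : (1 - t) • x + t • (x + h) = x + t • h := by module
    have h9 : ‖x - (x + h)‖ = ‖h‖ := by rw [sub_add_cancel_left, norm_neg]
    rw [h8, h9] at h7
    simp only [smul_eq_mul, zero_add, zero_smul, add_zero] at h7 ⊢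
    rw [inv_mul_le_iff₀ ht.1]
    nlinarith [h7])
  linarith

/-- The lower bound at `x + h` in direction `-h`, combined with the Lipschitz gradient. This avoids
integration at the price of `ℓ` instead of `ℓ / 2`. -/
theorem upper (hg : IsSmoothStronglyConvex g μ ℓ) (hμ : 0 ≤ μ) (x h : E) :
    g (x + h) ≤ g x + inner ℝ (gradient g x) h + ℓ * ‖h‖ ^ 2 := by
  have h1 := hg.lower (x + h) (-h)
  rw [add_neg_cancel_right, inner_neg_right, norm_neg] at h1
  have h2 := hg.smooth (x + h) x
  rw [add_sub_cancel_left] at h2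
  have h3 := real_inner_le_norm (gradient g (x + h) - gradient g x) h
  rw [inner_sub_left] at h3
  have h4 : ‖gradient g (x + h) - gradient g x‖ * ‖h‖ ≤ ℓ * ‖h‖ * ‖h‖ := by gcongr
  have : 0 ≤ μ / 2 * ‖h‖ ^ 2 := by positivity
  nlinarith

/-- Adding the two lower bounds between `0` and `h` shows that the gradient is `μ`-strongly
monotone, while Cauchy-Schwarz caps the same product by `ℓ * ‖h‖ ^ 2`. -/
theorem le_of_nontrivial [Nontrivial E] (hg : IsSmoothStronglyConvex g μ ℓ) : μ ≤ ℓ := by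
  obtain ⟨h, hh⟩ := exists_ne (0 : E)
  have hpos : 0 < ‖h‖ := norm_pos_iff.2 hh
  have h1 := hg.lower 0 h
  have h2 := hg.lower (0 + h) (-h)
  rw [add_neg_cancel_right, inner_neg_right, norm_neg] at h2
  have h3 := hg.smooth (0 + h) 0
  rw [add_sub_cancel_left] at h3
  have h4 := real_inner_le_norm (gradient g (0 + h) - gradient g 0) h
  rw [inner_sub_left] at h4
  have h5 : ‖gradient g (0 + h) - gradient g 0‖ * ‖h‖ ≤ ℓ * ‖h‖ * ‖h‖ := by gcongr
  have h6 : μ * ‖h‖ ^ 2 ≤ ℓ * ‖h‖ ^ 2 := by nlinarith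
  exact le_of_mul_le_mul_right h6 (by positivity)

theorem gradient_eq_zero (hg : IsSmoothStronglyConvex g μ ℓ) (hμ : 0 ≤ μ) {p : E}
    (hp : IsMinOn g univ p) : gradient g p = 0 := by
  have h1 : 0 ≤ inner ℝ (gradient g p) (-gradient g p) := by
    refine nonneg_of_mul_add_sq_nonneg (c := ℓ * ‖gradient g p‖ ^ 2) fun t ht _ => ?_
    have h2 := hg.upper hμ p (t • (-gradient g p))
    have h3 : g p ≤ g (p + t • (-gradient g p)) := hp (mem_univ _)
    rw [inner_smul_right, norm_smul, norm_neg, Real.norm_of_nonneg ht.le, mul_pow] at h2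
    linarith
  rw [inner_neg_right, real_inner_self_eq_norm_sq] at h1
  exact norm_eq_zero.1 (by nlinarith [norm_nonneg (gradient g p)])

/-- Quadratic growth and quadratic upper bound at the minimizer. -/
theorem growth (hg : IsSmoothStronglyConvex g μ ℓ) (hμ : 0 ≤ μ) {p : E}
    (hp : IsMinOn g univ p) (u : E) :
    μ / 2 * ‖u - p‖ ^ 2 ≤ g u - g p ∧ g u - g p ≤ ℓ * ‖u - p‖ ^ 2 ∧
      ‖gradient g u‖ ≤ ℓ * ‖u - p‖ := by
  have h0 := hg.gradient_eq_zero hμ hp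
  have h1 := hg.lower p (u - p)
  have h2 := hg.upper hμ p (u - p)
  have h3 := hg.smooth u p
  rw [h0, inner_zero_left, add_sub_cancel] at h1 h2
  rw [h0, sub_zero] at h3
  exact ⟨by linarith, by linarith, h3⟩

end IsSmoothStronglyConvex

end Locomotion

/-! ### Block-affine quadratic maps -/

namespace Locomotion

/-- A quadratic map `x ↦ c + M x + b(x, x)` on a product of `n` copies of `G` which is affine in
each block. -/
structure BlockQuadratic (n : ℕ) (G V : Type*) [NormedAddCommGroup G] [InnerProductSpace ℝ G]
    [NormedAddCommGroup V] [InnerProductSpace ℝ V] where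
  /-- the constant part -/
  const : V
  /-- the linear part -/
  lin : PiLp 2 (fun _ : Fin n => G) →ₗ[ℝ] V
  /-- the quadratic part, as a bilinear map -/
  bil : PiLp 2 (fun _ : Fin n => G) →ₗ[ℝ] PiLp 2 (fun _ : Fin n => G) →ₗ[ℝ] V
  bil_single : ∀ i u v, bil (PiLp.single 2 i u) (PiLp.single 2 i v) = 0

section

variable {n : ℕ} {G V : Type*} [NormedAddCommGroup G] [InnerProductSpace ℝ G]
  [NormedAddCommGroup V] [InnerProductSpace ℝ V]

namespace BlockQuadratic

/-- The value of a block-affine quadratic map. -/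
def eval (A : BlockQuadratic n G V) (x : PiLp 2 (fun _ : Fin n => G)) : V :=
  A.const + A.lin x + A.bil x x

/-- The derivative of a block-affine quadratic map at `x` in direction `e`. -/
def diff (A : BlockQuadratic n G V) (x : PiLp 2 (fun _ : Fin n => G)) :
    PiLp 2 (fun _ : Fin n => G) →ₗ[ℝ] V :=
  A.lin + A.bil x + A.bil.flip x

/-- Bounds on the linear and on the quadratic part. -/
structure IsBounded (A : BlockQuadratic n G V) (m q : ℝ) : Prop where
  lin_nonneg : 0 ≤ m
  bil_nonneg : 0 ≤ q
  norm_lin_le : ∀ x, ‖A.lin x‖ ≤ m * ‖x‖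
  norm_bil_le : ∀ x y, ‖A.bil x y‖ ≤ q * ‖x‖ * ‖y‖

variable (A : BlockQuadratic n G V) {m q : ℝ}

theorem diff_apply (x e : PiLp 2 (fun _ : Fin n => G)) :
    A.diff x e = A.lin e + A.bil x e + A.bil e x := rfl

theorem eval_add (x h : PiLp 2 (fun _ : Fin n => G)) :
    A.eval (x + h) = A.eval x + A.diff x h + A.bil h h := by
  simp only [eval, diff_apply, map_add, LinearMap.add_apply]
  abel

/-- No second-order remainder appears: this exactness makes each block subproblem convex. -/
theorem eval_add_single (x : PiLp 2 (fun _ : Fin n => G)) (i : Fin n) (u : G) :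
    A.eval (x + PiLp.single 2 i u) = A.eval x + A.diff x (PiLp.single 2 i u) := by
  rw [eval_add, A.bil_single, add_zero]

variable {A}

theorem IsBounded.norm_diff_le (hA : A.IsBounded m q) (x e : PiLp 2 (fun _ : Fin n => G)) :
    ‖A.diff x e‖ ≤ (m + 2 * q * ‖x‖) * ‖e‖ := by
  have h1 := norm_add₃_le (a := A.lin e) (b := A.bil x e) (c := A.bil e x)
  have h2 := hA.norm_lin_le e
  have h3 := hA.norm_bil_le x e
  have h4 := hA.norm_bil_le e x
  rw [diff_apply]
  nlinarith

theorem IsBounded.norm_diff_sub_le (hA : A.IsBounded m q) (x y e : PiLp 2 (fun _ : Fin n => G)) :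
    ‖A.diff x e - A.diff y e‖ ≤ 2 * q * ‖x - y‖ * ‖e‖ := by
  have h0 : A.diff x e - A.diff y e = A.bil (x - y) e + A.bil e (x - y) := by
    simp only [diff_apply, map_sub, LinearMap.sub_apply]
    abel
  have h1 := norm_add_le (A.bil (x - y) e) (A.bil e (x - y))
  have h3 := hA.norm_bil_le (x - y) e
  have h4 := hA.norm_bil_le e (x - y)
  rw [h0]
  nlinarith

theorem IsBounded.norm_eval_sub_le (hA : A.IsBounded m q) (x y : PiLp 2 (fun _ : Fin n => G)) :
    ‖A.eval x - A.eval y‖ ≤ (m + q * (‖x‖ + ‖y‖)) * ‖x - y‖ := by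
  have h0 : A.eval x - A.eval y = A.lin (x - y) + A.bil (x - y) x + A.bil y (x - y) := by
    simp only [eval, map_sub, LinearMap.sub_apply]
    abel
  have h1 := norm_add₃_le (a := A.lin (x - y)) (b := A.bil (x - y) x) (c := A.bil y (x - y))
  have h2 := hA.norm_lin_le (x - y)
  have h3 := hA.norm_bil_le (x - y) x
  have h4 := hA.norm_bil_le y (x - y)
  rw [h0]
  nlinarith

theorem IsBounded.norm_eval_le (hA : A.IsBounded m q) (x : PiLp 2 (fun _ : Fin n => G)) :
    ‖A.eval x‖ ≤ ‖A.const‖ + m * ‖x‖ + q * ‖x‖ ^ 2 := by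
  have h1 := norm_add₃_le (a := A.const) (b := A.lin x) (c := A.bil x x)
  have h2 := hA.norm_lin_le x
  have h3 := hA.norm_bil_le x x
  rw [eval]
  nlinarith

theorem IsBounded.continuous_eval (hA : A.IsBounded m q) : Continuous A.eval := by
  rw [continuous_iff_continuousAt]
  intro x
  rw [ContinuousAt, tendsto_iff_norm_sub_tendsto_zero]
  have hlim : Tendsto (fun y => (m + q * (‖y‖ + ‖x‖)) * ‖y - x‖) (𝓝 x)
      (𝓝 ((m + q * (‖x‖ + ‖x‖)) * ‖x - x‖)) := by
    refine Continuous.tendsto ?_ x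
    fun_prop
  rw [sub_self, norm_zero, mul_zero] at hlim
  exact squeeze_zero (fun _ => norm_nonneg _) (fun y => hA.norm_eval_sub_le y x) hlim

end BlockQuadratic

/-- The smooth part of the augmented Lagrangian. -/
noncomputable def lag (f : PiLp 2 (fun _ : Fin n => G) → ℝ) (φ : V → ℝ) (A : BlockQuadratic n G V) (ρ : ℝ)
    (x : PiLp 2 (fun _ : Fin n => G)) (z w : V) : ℝ :=
  f x + φ z + (inner ℝ w (A.eval x - z) + ρ / 2 * ‖A.eval x - z‖ ^ 2)

/-- The point whose first `k` blocks are those of `a` and whose other blocks are those of `b`. -/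
def mix (k : ℕ) (a b : PiLp 2 (fun _ : Fin n => G)) : PiLp 2 (fun _ : Fin n => G) :=
  WithLp.toLp 2 (fun l => if l.val < k then a l else b l)

theorem mix_zero (a b : PiLp 2 (fun _ : Fin n => G)) : mix 0 a b = b := by
  ext l
  simp [mix]

theorem mix_self (a b : PiLp 2 (fun _ : Fin n => G)) : mix n a b = a := by
  ext l
  simp [mix]

/-- `mix i` and `mix (i + 1)` are the points of the sweep before and after the update of block `i`.
-/
theorem mix_eq_mix_succ_add (a b : PiLp 2 (fun _ : Fin n => G)) (i : Fin n) :
    mix i a b = mix (i + 1) a b + PiLp.single 2 i (b i - a i) := by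
  ext l
  rcases lt_trichotomy l i with h | rfl | h
  · simp [mix, h, h.le, h.ne]
  · simp [mix]
  · simp [mix, h.not_gt, h.not_ge, h.ne']

theorem norm_sub_mix_le (k : ℕ) (a b : PiLp 2 (fun _ : Fin n => G)) :
    ‖a - mix k a b‖ ≤ ‖a - b‖ := by
  refine le_of_sq_le_sq ?_ (norm_nonneg _)
  rw [PiLp.norm_sq_eq_of_L2, PiLp.norm_sq_eq_of_L2]
  refine Finset.sum_le_sum fun l _ => ?_
  by_cases h : l.val < k <;> simp [mix, h]

/-- Iterates of ADMM with sequential updates of the blocks of `x`, for a real-valued Lagrangian on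
a product of sets. -/
structure IsBlockADMM (f : PiLp 2 (fun _ : Fin n => G) → ℝ) (φ : V → ℝ)
    (A : BlockQuadratic n G V) (X : Fin n → Set G) (ρ : ℝ)
    (x : ℕ → PiLp 2 (fun _ : Fin n => G)) (z w : ℕ → V) : Prop where
  mem : ∀ k i, x k i ∈ X i
  x_step : ∀ k i, ∀ u ∈ X i, lag f φ A ρ (mix (i + 1) (x (k + 1)) (x k)) (z k) (w k) ≤
    lag f φ A ρ (mix (i + 1) (x (k + 1)) (x k) + PiLp.single 2 i (u - x (k + 1) i)) (z k) (w k)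
  z_step : ∀ k v, lag f φ A ρ (x (k + 1)) (z (k + 1)) (w k) ≤ lag f φ A ρ (x (k + 1)) v (w k)
  w_step : ∀ k, w (k + 1) = w k + ρ • (A.eval (x (k + 1)) - z (k + 1))

variable {f : PiLp 2 (fun _ : Fin n => G) → ℝ} {φ : V → ℝ} {A : BlockQuadratic n G V}
  {X : Fin n → Set G} {ρ μf Lf μφ Lφ : ℝ}
  {x : ℕ → PiLp 2 (fun _ : Fin n => G)} {z w : ℕ → V}

theorem lag_add_single (s : PiLp 2 (fun _ : Fin n => G)) (z w : V) (i : Fin n) (u : G) :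
    lag f φ A ρ (s + PiLp.single 2 i u) z w = lag f φ A ρ s z w +
      (f (s + PiLp.single 2 i u) - f s +
        inner ℝ (w + ρ • (A.eval s - z)) (A.diff s (PiLp.single 2 i u)) +
        ρ / 2 * ‖A.diff s (PiLp.single 2 i u)‖ ^ 2) := by
  have h : A.eval (s + PiLp.single 2 i u) - z =
      (A.eval s - z) + A.diff s (PiLp.single 2 i u) := by rw [A.eval_add_single]; abel
  rw [lag, lag, h, norm_add_sq_real, inner_add_right, inner_add_left, real_inner_smul_left]
  ring

/-- At the new `x` and `z`, the multiplier `w + ρ • (A.eval s - z)` is exactly the updated dual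
variable. -/
theorem lag_add_dual (s : PiLp 2 (fun _ : Fin n => G)) (z v w : V) :
    lag f φ A ρ s (z + v) w = lag f φ A ρ s z w +
      (φ (z + v) - φ z - inner ℝ (w + ρ • (A.eval s - z)) v + ρ / 2 * ‖v‖ ^ 2) := by
  have h : A.eval s - (z + v) = (A.eval s - z) - v := by abel
  rw [lag, lag, h, norm_sub_sq_real, inner_sub_right, inner_add_left, real_inner_smul_left]
  ring

/-! ### Optimality conditions of the ADMM steps and sufficient decrease -/

namespace IsBlockADMM

theorem block_variational (H : IsBlockADMM f φ A X ρ x z w) [CompleteSpace G] (hX : ∀ i, Convex ℝ (X i)) (hμ : 0 ≤ μf)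
    (hf : IsSmoothStronglyConvex f μf Lf) (k : ℕ) (i : Fin n) {u : G} (hu : u ∈ X i) :
    0 ≤ inner ℝ (gradient f (mix (i + 1) (x (k + 1)) (x k)))
        (PiLp.single 2 i (u - x (k + 1) i)) +
      inner ℝ (w k + ρ • (A.eval (mix (i + 1) (x (k + 1)) (x k)) - z k))
        (A.diff (mix (i + 1) (x (k + 1)) (x k)) (PiLp.single 2 i (u - x (k + 1) i))) := by
  set s := mix (i + 1) (x (k + 1)) (x k) with hs
  set d := A.diff s (PiLp.single 2 i (u - x (k + 1) i)) with hd
  refine nonneg_of_mul_add_sq_nonneg (c := Lf * ‖u - x (k + 1) i‖ ^ 2 + ρ / 2 * ‖d‖ ^ 2)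
    fun t ht ht1 => ?_
  have hut : x (k + 1) i + t • (u - x (k + 1) i) ∈ X i :=
    (hX i).add_smul_sub_mem (H.mem _ _) hu ⟨ht.le, ht1⟩
  have h1 := H.x_step k i _ hut
  rw [← hs, lag_add_single, add_sub_cancel_left] at h1
  have h2 : (PiLp.single 2 i (t • (u - x (k + 1) i)) : PiLp 2 (fun _ : Fin n => G)) =
      t • PiLp.single 2 i (u - x (k + 1) i) := by
    rw [← PiLp.toLp_single, ← PiLp.toLp_single, Pi.single_smul', WithLp.toLp_smul]
  have h3 := hf.upper hμ s (t • PiLp.single 2 i (u - x (k + 1) i))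
  rw [h2, map_smul, ← hd, inner_smul_right, norm_smul, Real.norm_of_nonneg ht.le, mul_pow] at h1
  rw [inner_smul_right, norm_smul, Real.norm_of_nonneg ht.le, mul_pow, PiLp.norm_single] at h3
  linarith

theorem block_descent (H : IsBlockADMM f φ A X ρ x z w) [CompleteSpace G] (hX : ∀ i, Convex ℝ (X i)) (hμ : 0 ≤ μf) (hρ : 0 ≤ ρ)
    (hf : IsSmoothStronglyConvex f μf Lf) (k : ℕ) (i : Fin n) :
    lag f φ A ρ (mix (i + 1) (x (k + 1)) (x k)) (z k) (w k) + μf / 2 * ‖x (k + 1) i - x k i‖ ^ 2 ≤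
      lag f φ A ρ (mix i (x (k + 1)) (x k)) (z k) (w k) := by
  have h1 := H.block_variational hX hμ hf k i (H.mem k i)
  have h2 := hf.lower (mix (i + 1) (x (k + 1)) (x k)) (PiLp.single 2 i (x k i - x (k + 1) i))
  rw [PiLp.norm_single, norm_sub_rev] at h2
  rw [mix_eq_mix_succ_add _ _ i, lag_add_single]
  have h3 : 0 ≤ ρ / 2 * ‖A.diff (mix (i + 1) (x (k + 1)) (x k))
    (PiLp.single 2 i (x k i - x (k + 1) i))‖ ^ 2 := by positivity
  linarith

/-- The block decreases telescope along the sweep, and the squared block steps add up to the squared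
norm of the full step. -/
theorem x_descent (H : IsBlockADMM f φ A X ρ x z w) [CompleteSpace G] (hX : ∀ i, Convex ℝ (X i)) (hμ : 0 ≤ μf) (hρ : 0 ≤ ρ)
    (hf : IsSmoothStronglyConvex f μf Lf) (k : ℕ) :
    lag f φ A ρ (x (k + 1)) (z k) (w k) + μf / 2 * ‖x (k + 1) - x k‖ ^ 2 ≤
      lag f φ A ρ (x k) (z k) (w k) := by
  have h1 := Finset.sum_le_sum fun i (_ : i ∈ Finset.univ) =>
    H.block_descent hX hμ hρ hf k i
  rw [Finset.sum_add_distrib, ← Finset.mul_sum] at h1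
  have h2 : ∑ i : Fin n, ‖x (k + 1) i - x k i‖ ^ 2 = ‖x (k + 1) - x k‖ ^ 2 :=
    (PiLp.norm_sq_eq_of_L2 (fun _ : Fin n => G) (x (k + 1) - x k)).symm
  have h3 := Finset.sum_range_sub
    (fun j => lag f φ A ρ (mix j (x (k + 1)) (x k)) (z k) (w k)) n
  rw [Finset.sum_sub_distrib, Finset.sum_range, Finset.sum_range, mix_zero, mix_self] at h3
  rw [h2] at h1
  linarith

/-- Stationarity of the z-step, tested in the direction `-g`. Nothing of the kind holds for `w 0`,
so the later estimates start at index 1. -/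
theorem dual_eq (H : IsBlockADMM f φ A X ρ x z w) [CompleteSpace V] (hμ : 0 ≤ μφ) (hφ : IsSmoothStronglyConvex φ μφ Lφ) (k : ℕ) :
    w (k + 1) = gradient φ (z (k + 1)) := by
  set g := gradient φ (z (k + 1)) - w (k + 1) with hg
  have h1 : 0 ≤ inner ℝ g (-g) := by
    refine nonneg_of_mul_add_sq_nonneg (c := (Lφ + ρ / 2) * ‖g‖ ^ 2) fun t ht _ => ?_
    have h2 := H.z_step k (z (k + 1) + t • (-g))
    have h3 := hφ.upper hμ (z (k + 1)) (t • (-g))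
    rw [lag_add_dual, ← H.w_step] at h2
    have h4 : inner ℝ g (-g) = inner ℝ (gradient φ (z (k + 1))) (-g) - inner ℝ (w (k + 1)) (-g) := by
      rw [← inner_sub_left]
    rw [inner_smul_right, norm_smul, norm_neg, Real.norm_of_nonneg ht.le, mul_pow] at h2 h3
    rw [h4]
    linarith
  rw [inner_neg_right, real_inner_self_eq_norm_sq] at h1
  have h5 : g = 0 := norm_eq_zero.1 (by nlinarith [norm_nonneg g])
  rw [hg, sub_eq_zero] at h5
  exact h5.symm

theorem z_descent (H : IsBlockADMM f φ A X ρ x z w) [CompleteSpace V] (hμ : 0 ≤ μφ) (hρ : 0 ≤ ρ)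
    (hφ : IsSmoothStronglyConvex φ μφ Lφ) (k : ℕ) :
    lag f φ A ρ (x (k + 1)) (z (k + 1)) (w k) + μφ / 2 * ‖z (k + 1) - z k‖ ^ 2 ≤
      lag f φ A ρ (x (k + 1)) (z k) (w k) := by
  have h1 := hφ.lower (z (k + 1)) (z k - z (k + 1))
  have h2 := lag_add_dual (f := f) (φ := φ) (A := A) (ρ := ρ) (x (k + 1)) (z (k + 1))
    (z k - z (k + 1)) (w k)
  rw [← H.w_step, H.dual_eq hμ hφ, add_sub_cancel] at h2
  rw [add_sub_cancel] at h1
  rw [h2, norm_sub_rev]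
  have : 0 ≤ ρ / 2 * ‖z k - z (k + 1)‖ ^ 2 := by positivity
  linarith

theorem residual_eq (H : IsBlockADMM f φ A X ρ x z w) (hρ : 0 < ρ) (k : ℕ) :
    A.eval (x (k + 1)) - z (k + 1) = ρ⁻¹ • (w (k + 1) - w k) := by
  rw [H.w_step, add_sub_cancel_left, inv_smul_smul₀ hρ.ne']

theorem w_ascent (H : IsBlockADMM f φ A X ρ x z w) (hρ : 0 < ρ) (k : ℕ) :
    lag f φ A ρ (x (k + 1)) (z (k + 1)) (w (k + 1)) =
      lag f φ A ρ (x (k + 1)) (z (k + 1)) (w k) + ρ⁻¹ * ‖w (k + 1) - w k‖ ^ 2 := by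
  have h1 : inner ℝ (w (k + 1)) (A.eval (x (k + 1)) - z (k + 1)) =
      inner ℝ (w k) (A.eval (x (k + 1)) - z (k + 1)) + ρ⁻¹ * ‖w (k + 1) - w k‖ ^ 2 := by
    rw [← real_inner_self_eq_norm_sq, ← real_inner_smul_right, ← H.residual_eq hρ k,
      ← inner_add_left, add_sub_cancel]
  rw [lag, lag, h1]
  ring

theorem norm_dual_sub_le (H : IsBlockADMM f φ A X ρ x z w) [CompleteSpace V] (hμ : 0 ≤ μφ) (hφ : IsSmoothStronglyConvex φ μφ Lφ)
    (k : ℕ) : ‖w (k + 2) - w (k + 1)‖ ≤ Lφ * ‖z (k + 2) - z (k + 1)‖ := by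
  rw [H.dual_eq hμ hφ, H.dual_eq hμ hφ]
  exact hφ.smooth _ _

/-- Sufficient decrease of the augmented Lagrangian. -/
theorem descent (H : IsBlockADMM f φ A X ρ x z w) [CompleteSpace G] [CompleteSpace V] (hX : ∀ i, Convex ℝ (X i)) (hμf : 0 ≤ μf)
    (hμφ : 0 < μφ) (hLφ : 0 < Lφ) (hρ : 4 * Lφ ^ 2 / μφ ≤ ρ)
    (hf : IsSmoothStronglyConvex f μf Lf) (hφ : IsSmoothStronglyConvex φ μφ Lφ) (k : ℕ) :
    lag f φ A ρ (x (k + 2)) (z (k + 2)) (w (k + 2)) + (μf / 2 * ‖x (k + 2) - x (k + 1)‖ ^ 2 +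
      μφ / 4 * ‖z (k + 2) - z (k + 1)‖ ^ 2) ≤
      lag f φ A ρ (x (k + 1)) (z (k + 1)) (w (k + 1)) := by
  have hρ0 : 0 < ρ := lt_of_lt_of_le (by positivity) hρ
  have h1 := H.x_descent hX hμf hρ0.le hf (k + 1)
  have h2 := H.z_descent hμφ.le hρ0.le hφ (k + 1)
  have h3 := H.w_ascent hρ0 (k + 1)
  have h4 := H.norm_dual_sub_le hμφ.le hφ k
  -- The condition on `ρ` makes the dual ascent cost at most half of the gain `μφ / 2` of the
  -- z-step.
  have h5 : ρ⁻¹ * ‖w (k + 2) - w (k + 1)‖ ^ 2 ≤ μφ / 4 * ‖z (k + 2) - z (k + 1)‖ ^ 2 := by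
    rw [inv_mul_le_iff₀ hρ0]
    rw [div_le_iff₀ hμφ] at hρ
    calc ‖w (k + 2) - w (k + 1)‖ ^ 2 ≤ (Lφ * ‖z (k + 2) - z (k + 1)‖) ^ 2 := by gcongr
      _ = (4 * Lφ ^ 2) * (‖z (k + 2) - z (k + 1)‖ ^ 2 / 4) := by ring
      _ ≤ (ρ * μφ) * (‖z (k + 2) - z (k + 1)‖ ^ 2 / 4) := by gcongr
      _ = _ := by ring
  linarith

end IsBlockADMM

end

end Locomotion

/-! ### Bounds on the iterates and comparison with feasible values -/

namespace Locomotion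

section

variable {n : ℕ} {G V : Type*} [NormedAddCommGroup G] [InnerProductSpace ℝ G]
  [NormedAddCommGroup V] [InnerProductSpace ℝ V]
  {f : PiLp 2 (fun _ : Fin n => G) → ℝ} {φ : V → ℝ} {A : BlockQuadratic n G V}
  {X : Fin n → Set G} {ρ μf Lf μφ Lφ : ℝ}
  {x : ℕ → PiLp 2 (fun _ : Fin n => G)} {z w : ℕ → V}

theorem sum_single_apply (h : PiLp 2 (fun _ : Fin n => G)) :
    ∑ i, PiLp.single 2 i (h i) = h := by
  ext l
  rw [WithLp.ofLp_sum, Finset.sum_apply]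
  simp

theorem BlockQuadratic.IsBounded.mono {m q m' q' : ℝ} (hA : A.IsBounded m q) (hm : m ≤ m')
    (hq : q ≤ q') : A.IsBounded m' q' where
  lin_nonneg := hA.lin_nonneg.trans hm
  bil_nonneg := hA.bil_nonneg.trans hq
  norm_lin_le u := (hA.norm_lin_le u).trans (by gcongr)
  norm_bil_le u v := (hA.norm_bil_le u v).trans (by gcongr)

/-- If the dual variable is a gradient of `φ`, the augmented Lagrangian dominates `f + φ ∘ A`. -/
theorem le_lag [CompleteSpace V] (hμφ : 0 < μφ) (hle : μφ ≤ Lφ) (hρ : 4 * Lφ ^ 2 / μφ ≤ ρ)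
    (hφ : IsSmoothStronglyConvex φ μφ Lφ) (u : PiLp 2 (fun _ : Fin n => G)) (v : V) :
    f u + φ (A.eval u) + Lφ * ‖A.eval u - v‖ ^ 2 ≤ lag f φ A ρ u v (gradient φ v) := by
  have h1 := hφ.upper hμφ.le v (A.eval u - v)
  rw [add_sub_cancel] at h1
  -- Then `ρ / 2 - Lφ ≥ Lφ`: the penalty covers the error of linearizing `φ` at `v` and still leaves
  -- the residual term.
  have h2 : 4 * Lφ ≤ ρ := by
    refine le_trans ?_ hρ
    rw [le_div_iff₀ hμφ]
    nlinarith
  have h3 : 4 * Lφ * ‖A.eval u - v‖ ^ 2 ≤ ρ * ‖A.eval u - v‖ ^ 2 := by gcongr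
  rw [lag]
  linarith

theorem norm_sq_le_two_mul_add {E : Type*} [NormedAddCommGroup E] (u v : E) :
    ‖u‖ ^ 2 ≤ 2 * ‖u - v‖ ^ 2 + 2 * ‖v‖ ^ 2 := by
  have h1 : ‖u‖ ≤ ‖u - v‖ + ‖v‖ := by simpa using norm_add_le (u - v) v
  nlinarith [norm_nonneg u, norm_nonneg v, norm_nonneg (u - v), sq_nonneg (‖u - v‖ - ‖v‖)]

theorem norm_sub_sq_le_two_mul_add {E : Type*} [NormedAddCommGroup E] (u v : E) :
    ‖u - v‖ ^ 2 ≤ 2 * ‖u‖ ^ 2 + 2 * ‖v‖ ^ 2 := by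
  have h1 : ‖u - v‖ ≤ ‖u‖ + ‖v‖ := norm_sub_le u v
  nlinarith [norm_nonneg u, norm_nonneg v, norm_nonneg (u - v), sq_nonneg (‖u‖ - ‖v‖)]

/-- Young's inequality weighted so that only `μ / 4 * t ^ 2` is spent, a share that strong convexity
can pay. -/
theorem young_error {N P Q μ a b t : ℝ} (hμ : 0 < μ) :
    N * (P * a + Q * b) * t ≤ μ / 4 * t ^ 2 +
      2 * N ^ 2 * (P ^ 2 + Q ^ 2) / μ * (a ^ 2 + b ^ 2) := by
  have h1 : (P * a + Q * b) ^ 2 ≤ (P ^ 2 + Q ^ 2) * (a ^ 2 + b ^ 2) := by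
    nlinarith only [sq_nonneg (P * b - Q * a)]
  have h2 : 0 ≤ (P ^ 2 + Q ^ 2) * (a ^ 2 + b ^ 2) := by positivity
  have h3 : N ^ 2 * (P * a + Q * b) ^ 2 ≤ N ^ 2 * (2 * ((P ^ 2 + Q ^ 2) * (a ^ 2 + b ^ 2))) := by
    gcongr
    linarith only [h1, h2]
  have h4 : N * (P * a + Q * b) * t = μ / 4 * t ^ 2 + N ^ 2 * (P * a + Q * b) ^ 2 / μ -
      (μ / 2 * t - N * (P * a + Q * b)) ^ 2 / μ := by
    field_simp
    ring
  have h5 : 0 ≤ (μ / 2 * t - N * (P * a + Q * b)) ^ 2 / μ := by positivity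
  have h6 : N ^ 2 * (P * a + Q * b) ^ 2 / μ ≤
      N ^ 2 * (2 * ((P ^ 2 + Q ^ 2) * (a ^ 2 + b ^ 2))) / μ := by gcongr
  have h7 : N ^ 2 * (2 * ((P ^ 2 + Q ^ 2) * (a ^ 2 + b ^ 2))) / μ =
      2 * N ^ 2 * (P ^ 2 + Q ^ 2) / μ * (a ^ 2 + b ^ 2) := by ring
  linarith only [h4, h5, h6, h7]

namespace IsBlockADMM

theorem lag_le_lag_one [CompleteSpace G] [CompleteSpace V] (H : IsBlockADMM f φ A X ρ x z w)
    (hX : ∀ i, Convex ℝ (X i)) (hμf : 0 ≤ μf)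
    (hμφ : 0 < μφ) (hLφ : 0 < Lφ) (hρ : 4 * Lφ ^ 2 / μφ ≤ ρ)
    (hf : IsSmoothStronglyConvex f μf Lf) (hφ : IsSmoothStronglyConvex φ μφ Lφ) (k : ℕ) :
    lag f φ A ρ (x (k + 1)) (z (k + 1)) (w (k + 1)) ≤ lag f φ A ρ (x 1) (z 1) (w 1) := by
  induction k with
  | zero => exact le_rfl
  | succ k ih =>
    refine le_trans ?_ ih
    have h1 := H.descent hX hμf hμφ hLφ hρ hf hφ k
    have h2 : 0 ≤ μf / 2 * ‖x (k + 2) - x (k + 1)‖ ^ 2 + μφ / 4 * ‖z (k + 2) - z (k + 1)‖ ^ 2 := by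
      positivity
    exact le_trans (by linarith) h1

/-- Bound on the augmented Lagrangian after the first iteration, in terms of the gap of the
initial point. -/
theorem lag_one_le [CompleteSpace G] [CompleteSpace V] (H : IsBlockADMM f φ A X ρ x z w)
    (hX : ∀ i, Convex ℝ (X i)) (hμf : 0 ≤ μf)
    (hμφ : 0 < μφ) (hLφ : 0 < Lφ) (hρ : 0 < ρ)
    (hf : IsSmoothStronglyConvex f μf Lf) (hφ : IsSmoothStronglyConvex φ μφ Lφ)
    {xf : PiLp 2 (fun _ : Fin n => G)} {zφ : V} (hxf : IsMinOn f univ xf)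
    (hzφ : IsMinOn φ univ zφ) {C D : ℝ}
    (h0 : lag f φ A ρ (x 0) (z 0) (w 0) - f xf - φ zφ ≤ C) (hw : ‖w 0‖ ^ 2 ≤ D) :
    lag f φ A ρ (x 1) (z 1) (w 1) - f xf - φ zφ ≤
      C + ρ⁻¹ * (2 * (Lφ ^ 2 * (2 / μφ * (C + ρ⁻¹ * D))) + 2 * D) := by
  have h1 := H.x_descent hX hμf hρ.le hf 0
  have h2 := H.z_descent hμφ.le hρ.le hφ 0
  have h3 := H.w_ascent hρ 0
  simp only [zero_add] at h1 h2 h3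
  have h1' : 0 ≤ μf / 2 * ‖x 1 - x 0‖ ^ 2 := by positivity
  have h2' : 0 ≤ μφ / 2 * ‖z 1 - z 0‖ ^ 2 := by positivity
  obtain ⟨g1, -, g3⟩ := hφ.growth hμφ.le hzφ (z 1)
  have gf : f xf ≤ f (x 1) := hxf (mem_univ _)
  -- Since `w 0` need not be a gradient of `φ`, `le_lag` is unavailable here; completing the square
  -- bounds the coupling terms from below instead.
  have hsq : -(ρ⁻¹ * ‖w 0‖ ^ 2) ≤ inner ℝ (w 0) (A.eval (x 1) - z 1) +
      ρ / 2 * ‖A.eval (x 1) - z 1‖ ^ 2 := by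
    set p := A.eval (x 1) - z 1
    have k1 := neg_le_of_abs_le (abs_real_inner_le_norm (w 0) p)
    have k2 : ρ * (ρ⁻¹ * ‖w 0‖ ^ 2 - ‖w 0‖ * ‖p‖ + ρ / 2 * ‖p‖ ^ 2) =
      ‖w 0‖ ^ 2 - ρ * ‖w 0‖ * ‖p‖ + ρ ^ 2 / 2 * ‖p‖ ^ 2 := by
        field_simp
    have k3 : 0 ≤ ρ * (ρ⁻¹ * ‖w 0‖ ^ 2 - ‖w 0‖ * ‖p‖ + ρ / 2 * ‖p‖ ^ 2) := by
      rw [k2]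
      nlinarith [sq_nonneg (‖w 0‖ - ρ / 2 * ‖p‖), sq_nonneg (ρ * ‖p‖)]
    have k4 := nonneg_of_mul_nonneg_right k3 hρ
    linarith
  have hlag : lag f φ A ρ (x 1) (z 1) (w 0) = f (x 1) + φ (z 1) +
    (inner ℝ (w 0) (A.eval (x 1) - z 1) + ρ / 2 * ‖A.eval (x 1) - z 1‖ ^ 2) := rfl
  have hD : ρ⁻¹ * ‖w 0‖ ^ 2 ≤ ρ⁻¹ * D := by gcongr
  have hz : ‖z 1 - zφ‖ ^ 2 ≤ 2 / μφ * (C + ρ⁻¹ * D) := by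
    rw [div_mul_eq_mul_div, le_div_iff₀ hμφ]
    linarith
  have hw1 : ‖w 1‖ ^ 2 ≤ Lφ ^ 2 * ‖z 1 - zφ‖ ^ 2 := by
    have h4 := H.dual_eq hμφ.le hφ 0
    rw [zero_add] at h4
    rw [h4, ← mul_pow]
    gcongr
  have hww := norm_sub_sq_le_two_mul_add (w 1) (w 0)
  have h5 : ‖w 1 - w 0‖ ^ 2 ≤ 2 * (Lφ ^ 2 * (2 / μφ * (C + ρ⁻¹ * D))) + 2 * D := by
    have h6 : Lφ ^ 2 * ‖z 1 - zφ‖ ^ 2 ≤ Lφ ^ 2 * (2 / μφ * (C + ρ⁻¹ * D)) := by gcongr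
    linarith
  have h6 : ρ⁻¹ * ‖w 1 - w 0‖ ^ 2 ≤
    ρ⁻¹ * (2 * (Lφ ^ 2 * (2 / μφ * (C + ρ⁻¹ * D))) + 2 * D) := by gcongr
  linarith

/-- Bounds on the iterates in terms of the gap of the augmented Lagrangian. -/
theorem iterate_bounds [CompleteSpace G] [CompleteSpace V] (H : IsBlockADMM f φ A X ρ x z w)
    (hX : ∀ i, Convex ℝ (X i)) (hμf : 0 < μf)
    (hμφ : 0 < μφ) (hle : μφ ≤ Lφ) (hρ : 4 * Lφ ^ 2 / μφ ≤ ρ)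
    (hf : IsSmoothStronglyConvex f μf Lf) (hφ : IsSmoothStronglyConvex φ μφ Lφ)
    {xf : PiLp 2 (fun _ : Fin n => G)} {zφ : V} (hxf : IsMinOn f univ xf)
    (hzφ : IsMinOn φ univ zφ) {C : ℝ}
    (h1 : lag f φ A ρ (x 1) (z 1) (w 1) - f xf - φ zφ ≤ C) (k : ℕ) :
    ‖x (k + 1) - xf‖ ^ 2 ≤ 2 / μf * C ∧
      ‖z (k + 1) - zφ‖ ^ 2 ≤ 2 * (2 / μφ * C) + 2 * (C / Lφ) ∧
      ‖w (k + 1)‖ ^ 2 ≤ Lφ ^ 2 * (2 * (2 / μφ * C) + 2 * (C / Lφ)) := by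
  have hLφ : 0 < Lφ := hμφ.trans_le hle
  have h2 := H.lag_le_lag_one hX hμf.le hμφ hLφ hρ hf hφ k
  have h3 := le_lag (f := f) (A := A) hμφ hle hρ hφ (x (k + 1)) (z (k + 1))
  rw [← H.dual_eq hμφ.le hφ] at h3
  obtain ⟨g1, -, -⟩ := hf.growth hμf.le hxf (x (k + 1))
  obtain ⟨g2, -, -⟩ := hφ.growth hμφ.le hzφ (A.eval (x (k + 1)))
  obtain ⟨-, -, g3⟩ := hφ.growth hμφ.le hzφ (z (k + 1))
  rw [← H.dual_eq hμφ.le hφ] at g3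
  -- The gap dominates the sum of three nonnegative terms, so it bounds each of them.
  have p1 : 0 ≤ μf / 2 * ‖x (k + 1) - xf‖ ^ 2 := by positivity
  have p2 : 0 ≤ μφ / 2 * ‖A.eval (x (k + 1)) - zφ‖ ^ 2 := by positivity
  have p3 : 0 ≤ Lφ * ‖A.eval (x (k + 1)) - z (k + 1)‖ ^ 2 := by positivity
  have b1 : ‖x (k + 1) - xf‖ ^ 2 ≤ 2 / μf * C := by
    rw [div_mul_eq_mul_div, le_div_iff₀ hμf]
    linarith
  have b2 : ‖A.eval (x (k + 1)) - zφ‖ ^ 2 ≤ 2 / μφ * C := by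
    rw [div_mul_eq_mul_div, le_div_iff₀ hμφ]
    linarith
  have b3 : ‖A.eval (x (k + 1)) - z (k + 1)‖ ^ 2 ≤ C / Lφ := by
    rw [le_div_iff₀ hLφ]
    linarith
  have b4 : ‖z (k + 1) - zφ‖ ^ 2 ≤ 2 * (2 / μφ * C) + 2 * (C / Lφ) := by
    have h4 := norm_sub_sq_le_two_mul_add (A.eval (x (k + 1)) - zφ)
      (A.eval (x (k + 1)) - z (k + 1))
    rw [sub_sub_sub_cancel_left] at h4
    linarith
  refine ⟨b1, b4, ?_⟩
  calc ‖w (k + 1)‖ ^ 2 ≤ (Lφ * ‖z (k + 1) - zφ‖) ^ 2 := by gcongr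
    _ = Lφ ^ 2 * ‖z (k + 1) - zφ‖ ^ 2 := by ring
    _ ≤ _ := by gcongr

/-- The gradient of the Lagrangian at the new iterate is almost nonnegative in each admissible
block direction. -/
theorem block_error [CompleteSpace G] (H : IsBlockADMM f φ A X ρ x z w)
    (hX : ∀ i, Convex ℝ (X i)) (hμ : 0 ≤ μf) (hLf : 0 ≤ Lf) (hρ : 0 < ρ)
    (hf : IsSmoothStronglyConvex f μf Lf)
    {m R : ℝ} (hA : A.IsBounded m 1) (hR : 0 ≤ R)
    {k : ℕ} (hx : ‖x k‖ ≤ R) (hx' : ‖x (k + 1)‖ ≤ R) (hw : ‖w (k + 1)‖ ≤ R)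
    (i : Fin n) {u : G} (hu : u ∈ X i) :
    -((((Lf + 2 * R + ρ * (m + 6 * R) ^ 2) * ‖x (k + 1) - x k‖ +
        ρ * (m + 6 * R) * ‖z (k + 1) - z k‖)) * ‖u - x (k + 1) i‖) ≤
      inner ℝ (gradient f (x (k + 1))) (PiLp.single 2 i (u - x (k + 1) i)) +
      inner ℝ (w (k + 1)) (A.diff (x (k + 1)) (PiLp.single 2 i (u - x (k + 1) i))) := by
  have h0 := H.block_variational hX hμ hf k i hu
  set s := mix (i + 1) (x (k + 1)) (x k) with hs
  set e : PiLp 2 (fun _ : Fin n => G) := PiLp.single 2 i (u - x (k + 1) i) with he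
  have hen : ‖u - x (k + 1) i‖ = ‖e‖ := by rw [he, PiLp.norm_single]
  rw [hen]
  set dx := ‖x (k + 1) - x k‖ with hdx
  set dz := ‖z (k + 1) - z k‖ with hdz
  have hsx : ‖x (k + 1) - s‖ ≤ dx := norm_sub_mix_le _ _ _
  have hdxR : dx ≤ 2 * R := (norm_sub_le _ _).trans (by linarith)
  -- The point `s` lies within `dx ≤ 2 * R` of `x (k + 1)`.
  have hsR : ‖s‖ ≤ 3 * R := by
    have h1 := norm_sub_le (x (k + 1)) (x (k + 1) - s)
    rw [sub_sub_cancel] at h1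
    linarith
  have hm := hA.lin_nonneg
  -- The block condition holds at the intermediate point with old `z` and `w`. Passing to `w (k +
  -- 1)` leaves errors controlled by `dx` and `dz`.
  have hws : w k + ρ • (A.eval s - z k) =
      w (k + 1) + ρ • ((A.eval s - A.eval (x (k + 1))) + (z (k + 1) - z k)) := by
    rw [H.w_step]
    module
  rw [hws, inner_add_left] at h0
  have e1 : inner ℝ (gradient f s) e - inner ℝ (gradient f (x (k + 1))) e ≤ Lf * dx * ‖e‖ := by
    rw [← inner_sub_left]
    refine (real_inner_le_norm _ _).trans ?_
    have h1 := hf.smooth s (x (k + 1))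
    rw [norm_sub_rev s] at h1
    have h2 : Lf * ‖x (k + 1) - s‖ ≤ Lf * dx := by gcongr
    gcongr
    exact h1.trans h2
  have e2 : inner ℝ (w (k + 1)) (A.diff s e) - inner ℝ (w (k + 1)) (A.diff (x (k + 1)) e) ≤
      R * (2 * dx * ‖e‖) := by
    rw [← inner_sub_right]
    refine (real_inner_le_norm _ _).trans ?_
    have h1 := hA.norm_diff_sub_le s (x (k + 1)) e
    rw [norm_sub_rev s, mul_one] at h1
    have h2 : 2 * ‖x (k + 1) - s‖ * ‖e‖ ≤ 2 * dx * ‖e‖ := by gcongr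
    gcongr
    exact h1.trans h2
  have e3 : inner ℝ (ρ • ((A.eval s - A.eval (x (k + 1))) + (z (k + 1) - z k))) (A.diff s e) ≤
      ρ * ((m + 6 * R) * dx + dz) * ((m + 6 * R) * ‖e‖) := by
    refine (real_inner_le_norm _ _).trans ?_
    rw [norm_smul, Real.norm_of_nonneg hρ.le]
    have h1 : ‖A.eval s - A.eval (x (k + 1))‖ ≤ (m + 6 * R) * dx := by
      refine (hA.norm_eval_sub_le s (x (k + 1))).trans ?_
      rw [norm_sub_rev s]
      have h2 : m + 1 * (‖s‖ + ‖x (k + 1)‖) ≤ m + 6 * R := by linarith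
      gcongr
    have h2 : ‖A.diff s e‖ ≤ (m + 6 * R) * ‖e‖ := by
      refine (hA.norm_diff_le s e).trans ?_
      have h2 : m + 2 * 1 * ‖s‖ ≤ m + 6 * R := by linarith
      gcongr
    have h3 : ‖(A.eval s - A.eval (x (k + 1))) + (z (k + 1) - z k)‖ ≤ (m + 6 * R) * dx + dz :=
      (norm_add_le _ _).trans (by gcongr)
    gcongr
  linarith

/-- Comparison of the augmented Lagrangian at an iterate with the value of `f + φ ∘ A` at an
arbitrary admissible point. -/
theorem lag_le_value_add [CompleteSpace G] [CompleteSpace V] (H : IsBlockADMM f φ A X ρ x z w)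
    (hX : ∀ i, Convex ℝ (X i)) (hμf : 0 < μf) (hLf : 0 ≤ Lf) (hμφ : 0 ≤ μφ)
    (hρ : 0 < ρ)
    (hf : IsSmoothStronglyConvex f μf Lf) (hφ : IsSmoothStronglyConvex φ μφ Lφ)
    {m q R : ℝ} (hA : A.IsBounded m q) (hq1 : q ≤ 1) (hR : 0 ≤ R) (hqR : q * R ≤ μf / 4)
    (hx : ∀ k, ‖x (k + 1)‖ ≤ R) (hw : ∀ k, ‖w (k + 1)‖ ≤ R)
    {y : PiLp 2 (fun _ : Fin n => G)} (hy : ∀ i, y i ∈ X i) (k : ℕ) :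
    lag f φ A ρ (x (k + 2)) (z (k + 2)) (w (k + 2)) ≤ f y + φ (A.eval y) +
      (2 * n ^ 2 * ((Lf + 2 * R + ρ * (m + 6 * R) ^ 2) ^ 2 + (ρ * (m + 6 * R)) ^ 2) / μf +
        ρ⁻¹ * Lφ ^ 2) *
      (‖x (k + 2) - x (k + 1)‖ ^ 2 + ‖z (k + 2) - z (k + 1)‖ ^ 2) := by
  set P := Lf + 2 * R + ρ * (m + 6 * R) ^ 2 with hP
  set Q := ρ * (m + 6 * R) with hQ
  have hm := hA.lin_nonneg
  have hP0 : 0 ≤ P := by positivity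
  have hQ0 : 0 ≤ Q := by positivity
  set dx := ‖x (k + 2) - x (k + 1)‖ with hdx
  set dz := ‖z (k + 2) - z (k + 1)‖ with hdz
  set h := y - x (k + 2) with hh
  -- The derivative is linear, so the direction `h` splits into blocks. Each of the `n` block errors
  -- is bounded with `‖h‖`, hence the factor `n`.
  have hsum : inner ℝ (gradient f (x (k + 2))) h + inner ℝ (w (k + 2)) (A.diff (x (k + 2)) h) =
      ∑ i, (inner ℝ (gradient f (x (k + 2))) (PiLp.single 2 i (h i)) +
        inner ℝ (w (k + 2)) (A.diff (x (k + 2)) (PiLp.single 2 i (h i)))) := by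
    rw [Finset.sum_add_distrib, ← inner_sum, ← inner_sum, ← map_sum, sum_single_apply]
  have hlow : -(n * (P * dx + Q * dz) * ‖h‖) ≤
      inner ℝ (gradient f (x (k + 2))) h + inner ℝ (w (k + 2)) (A.diff (x (k + 2)) h) := by
    rw [hsum]
    have h1 : ∑ _i : Fin n, (-((P * dx + Q * dz) * ‖h‖)) = -(n * (P * dx + Q * dz) * ‖h‖) := by
      rw [Finset.sum_const, Finset.card_univ, Fintype.card_fin, nsmul_eq_mul]
      ring
    rw [← h1]
    refine Finset.sum_le_sum fun i _ => ?_
    have h2 := H.block_error hX hμf.le hLf hρ hf (hA.mono le_rfl hq1) hR (hx k) (hx (k + 1))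
      (hw (k + 1)) i (hy i)
    refine le_trans ?_ h2
    have h3 : ‖y i - x (k + 1 + 1) i‖ ≤ ‖h‖ := PiLp.norm_apply_le h i
    rw [neg_le_neg_iff]
    gcongr
  have hfl := hf.lower (x (k + 2)) h
  rw [hh, add_sub_cancel, ← hh] at hfl
  have hφl := hφ.lower (z (k + 2)) (A.eval y - z (k + 2))
  rw [add_sub_cancel, ← H.dual_eq hμφ hφ] at hφl
  have hAy : A.eval y - z (k + 2) = (A.eval (x (k + 2)) - z (k + 2)) + A.diff (x (k + 2)) h +
      A.bil h h := by
    have h1 := A.eval_add (x (k + 2)) h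
    rw [hh, add_sub_cancel, ← hh] at h1
    rw [h1]
    abel
  have hin : inner ℝ (w (k + 2)) (A.eval y - z (k + 2)) =
      inner ℝ (w (k + 2)) (A.eval (x (k + 2)) - z (k + 2)) +
      inner ℝ (w (k + 2)) (A.diff (x (k + 2)) h) + inner ℝ (w (k + 2)) (A.bil h h) := by
    rw [hAy, inner_add_right, inner_add_right]
  -- The only nonconvex term. Smallness of `q * R` lets it consume half of the `μf / 2` from strong
  -- convexity; `young_error` below uses the other half.
  have hbil : -(μf / 4 * ‖h‖ ^ 2) ≤ inner ℝ (w (k + 2)) (A.bil h h) := by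
    have h1 := neg_le_of_abs_le (abs_real_inner_le_norm (w (k + 2)) (A.bil h h))
    have h2 : ‖w (k + 2)‖ * ‖A.bil h h‖ ≤ R * (q * ‖h‖ * ‖h‖) := by
      gcongr
      · exact hw (k + 1)
      · exact hA.norm_bil_le h h
    have h3 : q * R * ‖h‖ ^ 2 ≤ μf / 4 * ‖h‖ ^ 2 := by gcongr
    linarith
  have hres : ρ / 2 * ‖A.eval (x (k + 2)) - z (k + 2)‖ ^ 2 ≤ ρ⁻¹ * Lφ ^ 2 * dz ^ 2 := by
    rw [H.residual_eq hρ, norm_smul, norm_inv, Real.norm_of_nonneg hρ.le, mul_pow]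
    have h1 : ‖w (k + 2) - w (k + 1)‖ ^ 2 ≤ (Lφ * dz) ^ 2 := by
      gcongr
      exact H.norm_dual_sub_le hμφ hφ k
    have h2 : ρ / 2 * (ρ⁻¹ ^ 2 * ‖w (k + 2) - w (k + 1)‖ ^ 2) =
      ρ⁻¹ / 2 * ‖w (k + 2) - w (k + 1)‖ ^ 2 := by
      field_simp
    have h3 : ρ⁻¹ / 2 * ‖w (k + 2) - w (k + 1)‖ ^ 2 ≤ ρ⁻¹ / 2 * (Lφ * dz) ^ 2 := by gcongr
    have h4 : 0 ≤ ρ⁻¹ / 2 * (Lφ * dz) ^ 2 := by positivity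
    change ρ / 2 * (ρ⁻¹ ^ 2 * ‖w (k + 2) - w (k + 1)‖ ^ 2) ≤ _
    rw [h2]
    linarith
  have hE : n * (P * dx + Q * dz) * ‖h‖ ≤ μf / 4 * ‖h‖ ^ 2 +
      2 * n ^ 2 * (P ^ 2 + Q ^ 2) / μf * (dx ^ 2 + dz ^ 2) := young_error hμf
  have hdx2 : 0 ≤ ρ⁻¹ * Lφ ^ 2 * dx ^ 2 := by positivity
  have hφ2 : 0 ≤ μφ / 2 * ‖A.eval y - z (k + 2)‖ ^ 2 := by positivity
  rw [lag, add_mul]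
  linarith

end IsBlockADMM

end

end Locomotion

/-! ### Uniform bounds and linear convergence -/

namespace Locomotion

/-- Because `q * S ≤ 1`, the quadratic term satisfies `q * (κ * S) ^ 2 ≤ κ ^ 2 * S`. Thus `A` grows
only linearly in `S`, and the gap is of order `S ^ 2` with a coefficient free of `q` and `n`. -/
theorem initial_gap_le {n : ℕ} {G V : Type*} [NormedAddCommGroup G] [InnerProductSpace ℝ G]
    [NormedAddCommGroup V] [InnerProductSpace ℝ V] [CompleteSpace G] [CompleteSpace V]
    {f : PiLp 2 (fun _ : Fin n => G) → ℝ} {φ : V → ℝ} {A : BlockQuadratic n G V}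
    {ρ μf Lf μφ Lφ κ m q a S : ℝ} (hμf : 0 ≤ μf) (hLf : 0 ≤ Lf) (hμφ : 0 ≤ μφ) (hLφ : 0 ≤ Lφ)
    (hρ : 0 ≤ ρ) (hf : IsSmoothStronglyConvex f μf Lf) (hφ : IsSmoothStronglyConvex φ μφ Lφ)
    {xf x : PiLp 2 (fun _ : Fin n => G)} {zφ z w : V} (hxf : IsMinOn f univ xf)
    (hzφ : IsMinOn φ univ zφ) (hA : A.IsBounded m q) (hAc : ‖A.const‖ ≤ a) (hκ : 0 ≤ κ)
    (ha : 0 ≤ a) (hS : 1 ≤ S) (hqS : q * S ≤ 1) (bxf : ‖xf‖ ≤ κ * S) (bzφ : ‖zφ‖ ≤ κ * S)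
    (bx : ‖x‖ ≤ κ * S) (bz : ‖z‖ ≤ κ * S) (bw : ‖w‖ ≤ κ * S) :
    lag f φ A ρ x z w - f xf - φ zφ ≤ (Lf * (2 * κ) ^ 2 + Lφ * (2 * κ) ^ 2 +
      (κ * ((a + m * κ + κ ^ 2) + κ) + ρ / 2 * ((a + m * κ + κ ^ 2) + κ) ^ 2)) * S ^ 2 := by
  have hS0 : 0 < S := by linarith
  have hm := hA.lin_nonneg
  have hAx : ‖A.eval x - z‖ ≤ ((a + m * κ + κ ^ 2) + κ) * S := by
    have h1 := hA.norm_eval_le x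
    have h2 := norm_sub_le (A.eval x) z
    have h3 : m * ‖x‖ ≤ m * (κ * S) := by gcongr
    have h4 : q * ‖x‖ ^ 2 ≤ q * (κ * S) ^ 2 := by
      have := hA.bil_nonneg
      gcongr
    have h5 : q * (κ * S) ^ 2 = (q * S) * (κ ^ 2 * S) := by ring
    have h6 : (q * S) * (κ ^ 2 * S) ≤ 1 * (κ ^ 2 * S) := by gcongr
    have h7 : a ≤ a * S := le_mul_of_one_le_right ha hS
    linarith
  obtain ⟨r, hr⟩ : ∃ r, r = (a + m * κ + κ ^ 2) + κ := ⟨_, rfl⟩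
  have hr0 : 0 ≤ r := by rw [hr]; positivity
  rw [← hr] at hAx ⊢
  obtain ⟨-, g1, -⟩ := hf.growth hμf hxf x
  obtain ⟨-, g2, -⟩ := hφ.growth hμφ hzφ z
  have h1 : ‖x - xf‖ ≤ 2 * κ * S := (norm_sub_le _ _).trans (by linarith)
  have h2 : ‖z - zφ‖ ≤ 2 * κ * S := (norm_sub_le _ _).trans (by linarith)
  have h3 : Lf * ‖x - xf‖ ^ 2 ≤ Lf * (2 * κ * S) ^ 2 := by gcongr
  have h4 : Lφ * ‖z - zφ‖ ^ 2 ≤ Lφ * (2 * κ * S) ^ 2 := by gcongr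
  have h5 : inner ℝ w (A.eval x - z) ≤ (κ * S) * (r * S) :=
    (real_inner_le_norm _ _).trans (by gcongr)
  have h6 : ρ / 2 * ‖A.eval x - z‖ ^ 2 ≤ ρ / 2 * (r * S) ^ 2 := by gcongr
  rw [lag]
  linarith

/-- The iterates of ADMM are bounded, with a constant that depends only on the constants of the
problem and scales linearly with the size `S` of the initial data. -/
theorem exists_iterate_bound {ρ μf Lf μφ Lφ κ m a : ℝ} (hμf : 0 < μf) (hLf : 0 < Lf) (hμφ : 0 < μφ)
    (hLφ : 0 < Lφ) (hρ : 4 * Lφ ^ 2 / μφ ≤ ρ) (hκ : 0 ≤ κ) (hm : 0 ≤ m) (ha : 0 ≤ a) :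
    ∃ C : ℝ, 0 < C ∧ ∀ (n : ℕ) (G V : Type) [NormedAddCommGroup G] [InnerProductSpace ℝ G]
      [NormedAddCommGroup V] [InnerProductSpace ℝ V] [CompleteSpace G] [CompleteSpace V]
      [Nontrivial V]
      (f : PiLp 2 (fun _ : Fin n => G) → ℝ) (φ : V → ℝ) (A : BlockQuadratic n G V)
      (X : Fin n → Set G) (x : ℕ → PiLp 2 (fun _ : Fin n => G)) (z w : ℕ → V)
      (xf : PiLp 2 (fun _ : Fin n => G)) (zφ : V) (q S : ℝ),
      IsBlockADMM f φ A X ρ x z w → (∀ i, Convex ℝ (X i)) →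
      IsSmoothStronglyConvex f μf Lf → IsSmoothStronglyConvex φ μφ Lφ →
      IsMinOn f univ xf → IsMinOn φ univ zφ → A.IsBounded m q → ‖A.const‖ ≤ a →
      1 ≤ S → q * S ≤ 1 → ‖xf‖ ≤ κ * S → ‖zφ‖ ≤ κ * S → ‖x 0‖ ≤ κ * S → ‖z 0‖ ≤ κ * S →
      ‖w 0‖ ≤ κ * S →
      ∀ k, ‖x (k + 1)‖ ≤ C * S ∧ ‖z (k + 1)‖ ≤ C * S ∧ ‖w (k + 1)‖ ≤ C * S := by
  have hρ0 : 0 < ρ := lt_of_lt_of_le (by positivity) hρ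
  obtain ⟨r, hr⟩ : ∃ r, r = (a + m * κ + κ ^ 2) + κ := ⟨_, rfl⟩
  have hr0 : 0 ≤ r := by rw [hr]; positivity
  -- Per unit of `S ^ 2`: `C₀` bounds the initial gap, `C₂` the gap after one iteration, `Bz` the
  -- squared distance of `z` to the minimizer, and `B` all squared norms. They are fixed before `n`,
  -- `q` and `S`.
  obtain ⟨C₀, hC₀⟩ : ∃ c, c = Lf * (2 * κ) ^ 2 + Lφ * (2 * κ) ^ 2 + (κ * r + ρ / 2 * r ^ 2) :=
    ⟨_, rfl⟩
  have hC₀0 : 0 ≤ C₀ := by rw [hC₀]; positivity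
  obtain ⟨C₂, hC₂⟩ : ∃ c, c = C₀ + ρ⁻¹ * (2 * (Lφ ^ 2 * (2 / μφ * (C₀ + ρ⁻¹ * κ ^ 2))) +
    2 * κ ^ 2) := ⟨_, rfl⟩
  have hC₂0 : 0 ≤ C₂ := by rw [hC₂]; positivity
  obtain ⟨Bz, hBz⟩ : ∃ c, c = 2 * (2 / μφ * C₂) + 2 * (C₂ / Lφ) := ⟨_, rfl⟩
  have hBz0 : 0 ≤ Bz := by rw [hBz]; positivity
  obtain ⟨B, hB⟩ : ∃ c, c = 2 * (2 / μf * C₂) + 2 * Bz + Lφ ^ 2 * Bz + 2 * κ ^ 2 := ⟨_, rfl⟩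
  refine ⟨√B + 1, by positivity, ?_⟩
  intro n G V _ _ _ _ _ _ _ f φ A X x z w xf zφ q S H hX hf hφ hxf hzφ hA hAc hS hqS bxf bzφ bx bz
    bw
  have hS0 : 0 < S := by linarith
  have hle : μφ ≤ Lφ := hφ.le_of_nontrivial
  have key : ∀ {E : Type} [NormedAddCommGroup E] (u : E), ‖u‖ ^ 2 ≤ B * S ^ 2 →
      ‖u‖ ≤ (√B + 1) * S := by
    intro E _ u hu
    have h1 : ‖u‖ ≤ √(B * S ^ 2) := Real.le_sqrt_of_sq_le hu
    rw [Real.sqrt_mul' _ (by positivity), Real.sqrt_sq hS0.le] at h1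
    linarith
  have h0 : lag f φ A ρ (x 0) (z 0) (w 0) - f xf - φ zφ ≤ C₀ * S ^ 2 := by
    rw [hC₀, hr]
    exact initial_gap_le hμf.le hLf.le hμφ.le hLφ.le hρ0.le hf hφ hxf hzφ hA hAc hκ ha hS hqS bxf
      bzφ bx bz bw
  have hw0 : ‖w 0‖ ^ 2 ≤ κ ^ 2 * S ^ 2 := by
    rw [← mul_pow]
    gcongr
  have h1 := H.lag_one_le hX hμf.le hμφ hLφ hρ0 hf hφ hxf hzφ h0 hw0
  have h2 : C₀ * S ^ 2 + ρ⁻¹ * (2 * (Lφ ^ 2 * (2 / μφ * (C₀ * S ^ 2 + ρ⁻¹ * (κ ^ 2 * S ^ 2)))) +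
      2 * (κ ^ 2 * S ^ 2)) = C₂ * S ^ 2 := by
    rw [hC₂]; ring
  rw [h2] at h1
  intro k
  obtain ⟨b1, b2, b3⟩ := H.iterate_bounds hX hμf hμφ hle hρ hf hφ hxf hzφ h1 k
  have h3 : 2 * (2 / μφ * (C₂ * S ^ 2)) + 2 * (C₂ * S ^ 2 / Lφ) = Bz * S ^ 2 := by rw [hBz]; ring
  have h4 : 2 / μf * (C₂ * S ^ 2) = 2 / μf * C₂ * S ^ 2 := by ring
  rw [h3] at b2 b3
  rw [h4] at b1
  have hxf2 : ‖xf‖ ^ 2 ≤ κ ^ 2 * S ^ 2 := by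
    rw [← mul_pow]
    gcongr
  have hzφ2 : ‖zφ‖ ^ 2 ≤ κ ^ 2 * S ^ 2 := by
    rw [← mul_pow]
    gcongr
  have h5 : B * S ^ 2 = 2 * (2 / μf * C₂ * S ^ 2) + 2 * (Bz * S ^ 2) + Lφ ^ 2 * (Bz * S ^ 2) +
    2 * (κ ^ 2 * S ^ 2) := by rw [hB]; ring
  have p1 : 0 ≤ 2 / μf * C₂ * S ^ 2 := by positivity
  have p2 : 0 ≤ Bz * S ^ 2 := by positivity
  have p3 : 0 ≤ Lφ ^ 2 * (Bz * S ^ 2) := by positivity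
  have p4 : 0 ≤ κ ^ 2 * S ^ 2 := by positivity
  refine ⟨key _ ?_, key _ ?_, key _ ?_⟩
  · have := norm_sq_le_two_mul_add (x (k + 1)) xf
    linarith
  · have := norm_sq_le_two_mul_add (z (k + 1)) zφ
    linarith
  · linarith

theorem cauchySeq_of_sq_le_geometric {E : Type*} [NormedAddCommGroup E] {u : ℕ → E} {c r : ℝ}
    (hr0 : 0 ≤ r) (hr : r < 1) (h : ∀ k, ‖u (k + 1) - u k‖ ^ 2 ≤ c * r ^ k) : CauchySeq u := by
  refine cauchySeq_of_le_geometric (√r) (√c) ?_ fun k => ?_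
  · rw [Real.sqrt_lt' one_pos]
    simpa using hr
  · have hc : 0 ≤ c := by simpa using (sq_nonneg _).trans (h 0)
    rw [dist_eq_norm']
    refine le_of_sq_le_sq ?_ (by positivity)
    rw [mul_pow, Real.sq_sqrt hc, ← pow_mul, mul_comm k 2, pow_mul, Real.sq_sqrt hr0]
    exact h k

/-- The hypothesis rearranges to `a (k + 1) ≤ θ / (1 + θ) * a k`. -/
theorem le_geometric_of_le_mul_sub {a : ℕ → ℝ} {θ : ℝ} (hθ : 0 < θ)
    (h : ∀ k, a (k + 1) ≤ θ * (a k - a (k + 1))) (k : ℕ) : a k ≤ a 0 * (θ / (1 + θ)) ^ k := by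
  induction k with
  | zero => simp
  | succ k ih =>
    have h1 : a (k + 1) ≤ θ / (1 + θ) * a k := by
      rw [div_mul_eq_mul_div, le_div_iff₀ (by positivity)]
      linarith [h k]
    have h2 : θ / (1 + θ) * a k ≤ θ / (1 + θ) * (a 0 * (θ / (1 + θ)) ^ k) := by gcongr
    calc a (k + 1) ≤ θ / (1 + θ) * (a 0 * (θ / (1 + θ)) ^ k) := h1.trans h2
      _ = _ := by ring

theorem tendsto_of_cauchySeq_succ {E : Type*} [UniformSpace E] [CompleteSpace E] [T2Space E]
    [FirstCountableTopology E] {u : ℕ → E} {p : E} (h : CauchySeq fun k => u (k + 1))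
    (hp : MapClusterPt p atTop u) : Tendsto u atTop (𝓝 p) := by
  obtain ⟨p', hp'⟩ := cauchySeq_tendsto_of_complete h
  rw [tendsto_add_atTop_iff_nat (f := u) 1] at hp'
  obtain ⟨ψ, hψ, hlim⟩ := hp.tendsto_subseq
  rwa [tendsto_nhds_unique hlim (hp'.comp hψ.tendsto_atTop)]

section

variable {n : ℕ} {G V : Type*} [NormedAddCommGroup G] [InnerProductSpace ℝ G]
  [NormedAddCommGroup V] [InnerProductSpace ℝ V] [CompleteSpace G] [CompleteSpace V]
  {f : PiLp 2 (fun _ : Fin n => G) → ℝ} {φ : V → ℝ} {A : BlockQuadratic n G V}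
  {X : Fin n → Set G} {ρ μf Lf μφ Lφ : ℝ}
  {x : ℕ → PiLp 2 (fun _ : Fin n => G)} {z w : ℕ → V}

/-- Linear convergence of ADMM to a global minimizer, from sufficient decrease of the augmented
Lagrangian and comparison with the values of `f + φ ∘ A`. -/
theorem IsBlockADMM.linear_convergence (H : IsBlockADMM f φ A X ρ x z w)
    (hX : ∀ i, IsClosed (X i)) (hμφ : 0 ≤ μφ) (hρ : 0 < ρ)
    (hf : IsSmoothStronglyConvex f μf Lf) (hφ : IsSmoothStronglyConvex φ μφ Lφ)
    {m q : ℝ} (hA : A.IsBounded m q) {c θ : ℝ} (hc : 0 < c) (hθ : 0 < θ)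
    (hdesc : ∀ k, lag f φ A ρ (x (k + 2)) (z (k + 2)) (w (k + 2)) +
      c * (‖x (k + 2) - x (k + 1)‖ ^ 2 + ‖z (k + 2) - z (k + 1)‖ ^ 2) ≤
      lag f φ A ρ (x (k + 1)) (z (k + 1)) (w (k + 1)))
    (hval : ∀ y : PiLp 2 (fun _ : Fin n => G), (∀ i, y i ∈ X i) → ∀ k,
      lag f φ A ρ (x (k + 2)) (z (k + 2)) (w (k + 2)) ≤ f y + φ (A.eval y) + θ * c *
      (‖x (k + 2) - x (k + 1)‖ ^ 2 + ‖z (k + 2) - z (k + 1)‖ ^ 2))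
    {xs : PiLp 2 (fun _ : Fin n => G)} {zs ws : V}
    (hp : MapClusterPt (xs, zs, ws) atTop (fun k => (x k, z k, w k))) :
    Tendsto (fun k => (x k, z k, w k)) atTop (𝓝 (xs, zs, ws)) ∧
      (∀ k, lag f φ A ρ xs zs ws ≤ lag f φ A ρ (x (k + 1)) (z (k + 1)) (w (k + 1))) ∧
      (∃ C, ∀ k, lag f φ A ρ (x (k + 1)) (z (k + 1)) (w (k + 1)) - lag f φ A ρ xs zs ws ≤
        C * (θ / (1 + θ)) ^ k) ∧
      (∀ i, xs i ∈ X i) ∧ zs = A.eval xs ∧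
      ∀ y : PiLp 2 (fun _ : Fin n => G), (∀ i, y i ∈ X i) →
        f xs + φ (A.eval xs) ≤ f y + φ (A.eval y) := by
  set u : ℕ → PiLp 2 (fun _ : Fin n => G) × V × V := fun k => (x k, z k, w k) with hu
  set Λ : ℕ → ℝ := fun k => lag f φ A ρ (x (k + 1)) (z (k + 1)) (w (k + 1)) with hΛ
  set d : ℕ → ℝ := fun k => ‖x (k + 2) - x (k + 1)‖ ^ 2 + ‖z (k + 2) - z (k + 1)‖ ^ 2 with hd
  set ℓ := lag f φ A ρ xs zs ws with hℓ
  have hd0 : ∀ k, 0 ≤ d k := fun k => by positivity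
  have hdx : ∀ k, ‖x (k + 2) - x (k + 1)‖ ^ 2 ≤ d k := fun k => le_add_of_nonneg_right (sq_nonneg _)
  have hdz : ∀ k, ‖z (k + 2) - z (k + 1)‖ ^ 2 ≤ d k := fun k => le_add_of_nonneg_left (sq_nonneg _)
  have hdw : ∀ k, ‖w (k + 2) - w (k + 1)‖ ^ 2 ≤ Lφ ^ 2 * d k := fun k => by
    calc ‖w (k + 2) - w (k + 1)‖ ^ 2 ≤ (Lφ * ‖z (k + 2) - z (k + 1)‖) ^ 2 := by
          gcongr
          exact H.norm_dual_sub_le hμφ hφ k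
      _ = Lφ ^ 2 * ‖z (k + 2) - z (k + 1)‖ ^ 2 := by ring
      _ ≤ Lφ ^ 2 * d k := by
          gcongr
          exact hdz k
  have hdesc' : ∀ k, Λ (k + 1) + c * d k ≤ Λ k := hdesc
  have hval' : ∀ y : PiLp 2 (fun _ : Fin n => G), (∀ i, y i ∈ X i) → ∀ k,
      Λ (k + 1) ≤ f y + φ (A.eval y) + θ * c * d k := hval
  have hanti : Antitone Λ := antitone_nat_of_succ_le fun k => by
    have h1 := hdesc' k
    have h2 : 0 ≤ c * d k := mul_nonneg hc.le (hd0 k)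
    linarith
  -- limits along the subsequence
  obtain ⟨ψ, hψ, hlim⟩ := hp.tendsto_subseq
  have hcA := hA.continuous_eval
  have hcf : Continuous f := hf.contDiff.continuous
  have hcφ : Continuous φ := hφ.contDiff.continuous
  have hcL : Continuous fun p : PiLp 2 (fun _ : Fin n => G) × V × V =>
      lag f φ A ρ p.1 p.2.1 p.2.2 := by
    unfold lag
    fun_prop
  have hΛψ : Tendsto (fun j => lag f φ A ρ (x (ψ j)) (z (ψ j)) (w (ψ j))) atTop (𝓝 ℓ) :=
    (hcL.tendsto (xs, zs, ws)).comp hlim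
  have hge : ∀ k, ℓ ≤ Λ k := fun k => by
    refine le_of_tendsto hΛψ ?_
    filter_upwards [eventually_ge_atTop (k + 1)] with j hj
    have h1 : k + 1 ≤ ψ j := hj.trans (hψ.id_le j)
    obtain ⟨l, hl⟩ := Nat.exists_eq_add_of_le' (le_trans (Nat.le_add_left 1 k) h1)
    rw [hl]
    exact hanti (by omega)
  -- A decreasing sequence bounded below converges, and the subsequence identifies its limit as `ℓ`.
  have hΛlim : Tendsto Λ atTop (𝓝 ℓ) := by
    have h1 := tendsto_atTop_ciInf hanti ⟨ℓ, by rintro _ ⟨k, rfl⟩; exact hge k⟩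
    have h2 : Tendsto (fun k => lag f φ A ρ (x k) (z k) (w k)) atTop (𝓝 (⨅ k, Λ k)) :=
      (tendsto_add_atTop_iff_nat 1).1 h1
    rwa [tendsto_nhds_unique (h2.comp hψ.tendsto_atTop) hΛψ] at h1
  have hdlim : Tendsto d atTop (𝓝 0) := by
    have h1 : Tendsto (fun k => (Λ k - Λ (k + 1)) / c) atTop (𝓝 ((ℓ - ℓ) / c)) :=
      (hΛlim.sub (hΛlim.comp (tendsto_add_atTop_nat 1))).div_const c
    rw [sub_self, zero_div] at h1
    refine squeeze_zero hd0 (fun k => ?_) h1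
    rw [le_div_iff₀ hc]
    linarith [hdesc' k]
  have hmem : ∀ i, xs i ∈ X i := fun i => by
    have hci : Continuous fun p : PiLp 2 (fun _ : Fin n => G) × V × V => p.1 i := by fun_prop
    exact (hX i).mem_of_tendsto ((hci.tendsto (xs, zs, ws)).comp hlim)
      (Eventually.of_forall fun j => H.mem (ψ j) i)
  have hres : A.eval xs - zs = 0 := by
    have hcr : Continuous fun p : PiLp 2 (fun _ : Fin n => G) × V × V =>
      A.eval p.1 - p.2.1 := by fun_prop
    have h1 := (hcr.tendsto (xs, zs, ws)).comp hlim
    -- The residual is `ρ⁻¹` times a dual increment, which is controlled by the vanishing `d k`.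
    have h2 : Tendsto (fun k => A.eval (x (k + 2)) - z (k + 2)) atTop (𝓝 0) := by
      rw [tendsto_zero_iff_norm_tendsto_zero]
      have h3 : Tendsto (fun k => √((ρ⁻¹ * Lφ) ^ 2 * d k)) atTop (𝓝 √((ρ⁻¹ * Lφ) ^ 2 * 0)) :=
        (hdlim.const_mul _).sqrt
      rw [mul_zero, Real.sqrt_zero] at h3
      refine squeeze_zero (fun _ => norm_nonneg _) (fun k => ?_) h3
      refine Real.le_sqrt_of_sq_le ?_
      rw [H.residual_eq hρ, norm_smul, norm_inv, Real.norm_of_nonneg hρ.le, mul_pow, mul_pow,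
        mul_assoc]
      gcongr
      exact hdw k
    have h4 := (tendsto_add_atTop_iff_nat (f := fun k => A.eval (x k) - z k) 2).1 h2
    exact tendsto_nhds_unique h1 (h4.comp hψ.tendsto_atTop)
  have hℓval : ℓ = f xs + φ (A.eval xs) := by
    rw [hℓ, lag, hres, ← sub_eq_zero.1 hres]
    simp
  -- Comparison with `y = xs`, whose value is `ℓ`; sufficient decrease then bounds `c * d k` by `Λ k
  -- - Λ (k + 1)`.
  have hgeo : ∀ k, Λ k - ℓ ≤ (Λ 0 - ℓ) * (θ / (1 + θ)) ^ k :=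
    le_geometric_of_le_mul_sub (a := fun k => Λ k - ℓ) hθ fun k => by
      have h1 := hval' xs hmem k
      rw [← hℓval] at h1
      have h2 : θ * (c * d k) ≤ θ * (Λ k - Λ (k + 1)) := by
        gcongr
        linarith [hdesc' k]
      linarith
  have hr0 : 0 ≤ θ / (1 + θ) := by positivity
  have hr1 : θ / (1 + θ) < 1 := by
    rw [div_lt_one (by positivity)]
    linarith
  have hdgeo : ∀ k, d k ≤ (Λ 0 - ℓ) / c * (θ / (1 + θ)) ^ k := fun k => by
    rw [div_mul_eq_mul_div, le_div_iff₀ hc]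
    linarith [hdesc' k, hgeo k, hge (k + 1)]
  have hcauchy : CauchySeq fun k => u (k + 1) := by
    refine CauchySeq.prodMk ?_ (CauchySeq.prodMk ?_ ?_)
    · exact cauchySeq_of_sq_le_geometric hr0 hr1 fun k => (hdx k).trans (hdgeo k)
    · exact cauchySeq_of_sq_le_geometric hr0 hr1 fun k => (hdz k).trans (hdgeo k)
    · refine cauchySeq_of_sq_le_geometric (c := Lφ ^ 2 * ((Λ 0 - ℓ) / c)) hr0 hr1 fun k =>
        (hdw k).trans ?_
      rw [mul_assoc]
      gcongr
      exact hdgeo k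
  refine ⟨tendsto_of_cauchySeq_succ hcauchy hp, hge, ⟨_, hgeo⟩, hmem, (sub_eq_zero.1 hres).symm,
    fun y hy => ?_⟩
  rw [← hℓval]
  have h1 : Tendsto (fun k => f y + φ (A.eval y) + θ * c * d k) atTop
      (𝓝 (f y + φ (A.eval y) + θ * c * 0)) := (hdlim.const_mul _).const_add _
  rw [mul_zero, add_zero] at h1
  exact le_of_tendsto_of_tendsto' (hΛlim.comp (tendsto_add_atTop_nat 1)) h1 (hval' y hy)

end

end Locomotion

/-! ### The dynamics as a block-affine quadratic map -/

noncomputable section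

namespace Locomotion

theorem norm_cross_le (a b : Vec) : ‖cross a b‖ ≤ ‖a‖ * ‖b‖ := by
  rw [cross, InnerProductGeometry.norm_ofLp_crossProduct]
  exact mul_le_of_le_one_right (by positivity) (Real.sin_le_one _)

/-- The cross product as a bilinear map. -/
def crossLin : Vec →ₗ[ℝ] Vec →ₗ[ℝ] Vec :=
  LinearMap.mk₂ ℝ cross (by intros; simp [cross]) (by intros; simp [cross])
    (by intros; simp [cross]) (by intros; simp [cross])

theorem crossLin_apply (a b : Vec) : crossLin a b = cross a b := rfl

variable {N T : ℕ}

/-- The block `x_i` of the forces, as a linear map. -/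
def blockLin (i : Fin (T + 1)) : Forces N T →ₗ[ℝ] Block N where
  toFun x := x i
  map_add' _ _ := rfl
  map_smul' _ _ := rfl

/-- The force of end-effector `j` in a block, as a linear map. -/
def forceLin (j : Fin N) : Block N →ₗ[ℝ] Vec where
  toFun x := x j
  map_add' _ _ := rfl
  map_smul' _ _ := rfl

/-- The position of the center of mass in the absence of contact forces. -/
def comFree (T : ℕ) (B : RobotData) (Δt : ℝ) (i : ℕ) : Vec :=
  B.comInit + ((i : ℝ) * Δt) • B.velInit +
    ∑ i' : Fin (T + 1) with i'.val + 2 ≤ i, (((i : ℝ) - 1 - (i'.val : ℝ)) * Δt ^ 2) • B.gravity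

/-- The contribution of the contact forces to the position of the center of mass. -/
def comLin (B : RobotData) (Δt : ℝ) (i : ℕ) : Forces N T →ₗ[ℝ] Vec :=
  ∑ i' : Fin (T + 1) with i'.val + 2 ≤ i, (((i : ℝ) - 1 - (i'.val : ℝ)) * Δt ^ 2) •
    ((∑ l : Fin N, (1 / B.mass) • forceLin l) ∘ₗ blockLin i')

theorem comPos_eq (B : RobotData) (Δt : ℝ) (x : Forces N T) (i : ℕ) :
    comPos B Δt x i = comFree T B Δt i + comLin B Δt i x := by
  simp only [comPos, comFree, comLin, LinearMap.sum_apply, LinearMap.smul_apply, smul_add,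
    Finset.sum_add_distrib, LinearMap.comp_apply]
  rw [add_assoc _ (∑ _ ∈ _, _), add_comm (∑ _ ∈ _, (_ • B.gravity))]
  rfl

/-- Extension of a family of `T` vectors by a zero first entry. -/
def consZero : (Fin T → Vec) →ₗ[ℝ] Momenta T where
  toFun y := WithLp.toLp 2 (Fin.cases 0 y)
  map_add' y y' := by
    ext l
    refine Fin.cases ?_ (fun i => ?_) l <;> simp
  map_smul' c y := by
    ext l
    refine Fin.cases ?_ (fun i => ?_) l <;> simp

/-- Entry `i + 1` is controlled by block `i` alone, so the squares can be summed with no loss in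
`T`. -/
theorem norm_consZero_le {y : Fin T → Vec} {x : Forces N T} {c : ℝ} (hc : 0 ≤ c)
    (h : ∀ i, ‖y i‖ ≤ c * ‖x i.castSucc‖) : ‖consZero y‖ ≤ c * ‖x‖ := by
  refine le_of_sq_le_sq ?_ (by positivity)
  rw [mul_pow, PiLp.norm_sq_eq_of_L2, PiLp.norm_sq_eq_of_L2, Fin.sum_univ_succ,
    Fin.sum_univ_castSucc (f := fun i => ‖x i‖ ^ 2)]
  have h1 : ∑ i : Fin T, ‖y i‖ ^ 2 ≤ c ^ 2 * ∑ i : Fin T, ‖x i.castSucc‖ ^ 2 := by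
    rw [Finset.mul_sum]
    refine Finset.sum_le_sum fun i _ => ?_
    rw [← mul_pow]
    gcongr
    exact h i
  have h2 : 0 ≤ c ^ 2 * ‖x (Fin.last T)‖ ^ 2 := by positivity
  have h3 : ‖(consZero y) 0‖ ^ 2 = 0 := by simp [consZero]
  have h4 : ∀ i : Fin T, (consZero y) i.succ = y i := fun i => rfl
  simp only [h3, h4]
  linarith

/-- The dynamics as a block-affine quadratic map. -/
def dynamics (B : RobotData) (Δt : ℝ) (r : Fin T → Fin N → Vec) :
    BlockQuadratic (T + 1) (Block N) (Momenta T) where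
  const := WithLp.toLp 2 (Fin.cases B.angInit 0)
  lin := consZero ∘ₗ LinearMap.pi fun i : Fin T =>
    Δt • ∑ j, crossLin (r i j - comFree T B Δt i) ∘ₗ forceLin j ∘ₗ blockLin i.castSucc
  bil := LinearMap.mk₂ ℝ
    (fun g x => consZero fun i : Fin T =>
      (-Δt) • ∑ j, crossLin (comLin B Δt i g) (x i.castSucc j))
    (fun g g' x => by
      rw [← map_add]
      congr 1
      ext1 i
      simp [Finset.sum_add_distrib])
    (fun c g x => by
      rw [← map_smul]
      congr 1
      ext1 i
      simp [Finset.smul_sum, smul_comm c])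
    (fun g x x' => by
      rw [← map_add]
      congr 1
      ext1 i
      simp [Finset.sum_add_distrib])
    (fun c g x => by
      rw [← map_smul]
      congr 1
      ext1 i
      simp [Finset.smul_sum, smul_comm c])
  bil_single k u v := by
    rw [LinearMap.mk₂_apply, ← map_zero consZero]
    congr 1
    ext1 i
    -- Either the force factor `x_i` vanishes, or `k = i` and the lever arm vanishes, because `c_i`
    -- involves only blocks up to `i - 2`.
    by_cases h : i.castSucc = k
    · have h1 : comLin B Δt i (PiLp.single 2 k u : Forces N T) = 0 := by
        rw [comLin, LinearMap.sum_apply]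
        refine Finset.sum_eq_zero fun i' hi' => ?_
        have h2 : i' ≠ k := by
          rintro rfl
          have h3 := (Finset.mem_filter.1 hi').2
          have h4 : i'.val = i.val := by rw [← h]; rfl
          omega
        have h5 : blockLin i' (PiLp.single 2 k u : Forces N T) = 0 :=
          PiLp.single_eq_of_ne (β := fun _ : Fin (T + 1) => Block N) 2 h2 u
        rw [LinearMap.smul_apply, LinearMap.comp_apply, h5, map_zero, smul_zero]
      simp [h1]
    · simp [h]

theorem momentumMap_eq (B : RobotData) (Δt : ℝ) (r : Fin T → Fin N → Vec) (x : Forces N T) :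
    momentumMap B Δt r x = (dynamics B Δt r).eval x := by
  ext1 l
  refine Fin.cases ?_ (fun i => ?_) l
  · simp [momentumMap, BlockQuadratic.eval, dynamics, consZero]
  · have h1 : ∀ j, cross (r i j - comPos B Δt x i) (x i.castSucc j) =
        crossLin (r i j - comFree T B Δt i) (x i.castSucc j) -
          crossLin (comLin B Δt i x) (x i.castSucc j) := fun j => by
      rw [comPos_eq, ← crossLin_apply, ← sub_sub, map_sub, LinearMap.sub_apply]
    have h2 : momentumMap B Δt r x i.succ =
      Δt • ∑ j : Fin N, cross (r i j - comPos B Δt x i) (x i.castSucc j) := rfl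
    have h3 : (dynamics B Δt r).eval x i.succ = 0 +
      (Δt • ∑ j, crossLin (r i j - comFree T B Δt i) ∘ₗ forceLin j ∘ₗ blockLin i.castSucc) x +
        (-Δt) • ∑ j, crossLin (comLin B Δt i x) (x i.castSucc j) := rfl
    rw [h2, h3]
    simp only [h1, Finset.sum_sub_distrib, LinearMap.smul_apply, LinearMap.sum_apply,
      LinearMap.comp_apply]
    rw [zero_add, smul_sub, neg_smul, ← sub_eq_add_neg]
    rfl

theorem sum_norm_le_sqrt_mul_norm {ι G : Type*} [Fintype ι] [NormedAddCommGroup G]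
    (x : PiLp 2 (fun _ : ι => G)) : ∑ i, ‖x i‖ ≤ √(Fintype.card ι) * ‖x‖ := by
  refine le_of_sq_le_sq ?_ (by positivity)
  rw [mul_pow, Real.sq_sqrt (by positivity), PiLp.norm_sq_eq_of_L2]
  exact sq_sum_le_card_mul_sum_sq

theorem sum_norm_le_card_mul_norm (x : Block N) : ∑ j, ‖x j‖ ≤ N * ‖x‖ := by
  refine (Finset.sum_le_sum fun j _ => PiLp.norm_apply_le x j).trans ?_
  rw [Finset.sum_const, Finset.card_univ, Fintype.card_fin, nsmul_eq_mul]

theorem abs_coeff_le {i i' : ℕ} (h : i' + 2 ≤ i) (hi : i ≤ T) (Δt : ℝ) :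
    |((i : ℝ) - 1 - (i' : ℝ)) * Δt ^ 2| ≤ T * Δt ^ 2 := by
  have h1 : (i' : ℝ) + 2 ≤ i := by exact_mod_cast h
  have h2 : (i : ℝ) ≤ T := by exact_mod_cast hi
  have h3 : (0 : ℝ) ≤ i' := by positivity
  rw [abs_of_nonneg (mul_nonneg (by linarith) (sq_nonneg _))]
  gcongr
  linarith

/-- Each coefficient is at most `T * Δt ^ 2`; Cauchy-Schwarz over the `T + 1` blocks produces the
square root. -/
theorem norm_comLin_le {B : RobotData} (hB : 0 < B.mass) (Δt : ℝ) {i : ℕ} (hi : i ≤ T)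
    (x : Forces N T) :
    ‖comLin B Δt i x‖ ≤ T * Δt ^ 2 * (N / B.mass) * √((T + 1 : ℕ)) * ‖x‖ := by
  have h1 : ∀ i' : Fin (T + 1), ‖((∑ l : Fin N, (1 / B.mass) • forceLin l) ∘ₗ blockLin i') x‖ ≤
      N / B.mass * ‖x i'‖ := fun i' => by
    have h2 : ((∑ l : Fin N, (1 / B.mass) • forceLin l) ∘ₗ blockLin i') x =
        (1 / B.mass) • ∑ l : Fin N, x i' l := by
      rw [LinearMap.comp_apply, LinearMap.sum_apply, Finset.smul_sum]
      rfl
    rw [h2, norm_smul, Real.norm_of_nonneg (by positivity)]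
    calc 1 / B.mass * ‖∑ l : Fin N, x i' l‖ ≤ 1 / B.mass * (N * ‖x i'‖) := by
          gcongr
          exact (norm_sum_le _ _).trans (sum_norm_le_card_mul_norm _)
      _ = _ := by ring
  rw [comLin, LinearMap.sum_apply]
  calc _ ≤ ∑ i' : Fin (T + 1) with i'.val + 2 ≤ i, T * Δt ^ 2 * (N / B.mass * ‖x i'‖) := by
        refine norm_sum_le_of_le _ fun i' hi' => ?_
        rw [LinearMap.smul_apply, norm_smul]
        gcongr
        · exact abs_coeff_le (Finset.mem_filter.1 hi').2 hi Δt
        · exact h1 i'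
    _ ≤ ∑ i' : Fin (T + 1), T * Δt ^ 2 * (N / B.mass * ‖x i'‖) :=
        Finset.sum_le_sum_of_subset_of_nonneg (Finset.filter_subset _ _)
          fun _ _ _ => by positivity
    _ = T * Δt ^ 2 * (N / B.mass) * ∑ i' : Fin (T + 1), ‖x i'‖ := by
        rw [Finset.mul_sum]
        exact Finset.sum_congr rfl fun _ _ => by ring
    _ ≤ T * Δt ^ 2 * (N / B.mass) * (√((T + 1 : ℕ)) * ‖x‖) := by
        gcongr
        simpa using sum_norm_le_sqrt_mul_norm x
    _ = _ := by ring

theorem norm_comFree_le {B : RobotData} {Δt D : ℝ} (h0 : 0 < Δt) (h1 : Δt ≤ 1)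
    (hD : T * Δt ≤ D) {i : ℕ} (hi : i ≤ T) :
    ‖comFree T B Δt i‖ ≤ ‖B.comInit‖ + D * ‖B.velInit‖ + D * (D + 1) * ‖B.gravity‖ := by
  have hi' : (i : ℝ) ≤ T := by exact_mod_cast hi
  have hD0 : 0 ≤ D := le_trans (by positivity) hD
  refine norm_add₃_le.trans ?_
  gcongr
  · rw [norm_smul, Real.norm_of_nonneg (by positivity)]
    gcongr
    exact le_trans (by gcongr) hD
  · calc _ ≤ ∑ i' : Fin (T + 1) with i'.val + 2 ≤ i, T * Δt ^ 2 * ‖B.gravity‖ := by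
          refine norm_sum_le_of_le _ fun i' hi' => ?_
          rw [norm_smul]
          gcongr
          exact abs_coeff_le (Finset.mem_filter.1 hi').2 hi Δt
      _ ≤ ∑ i' : Fin (T + 1), T * Δt ^ 2 * ‖B.gravity‖ :=
          Finset.sum_le_sum_of_subset_of_nonneg (Finset.filter_subset _ _)
            fun _ _ _ => by positivity
      _ = (T * Δt) * (T * Δt + Δt) * ‖B.gravity‖ := by
          rw [Finset.sum_const, Finset.card_univ, Fintype.card_fin, nsmul_eq_mul]
          push_cast
          ring
      _ ≤ D * (D + 1) * ‖B.gravity‖ := by gcongr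

theorem norm_sum_cross_le {a : Fin N → Vec} {c : ℝ} (hc : 0 ≤ c) (ha : ∀ j, ‖a j‖ ≤ c)
    (x : Block N) : ‖∑ j, crossLin (a j) (x j)‖ ≤ N * c * ‖x‖ := by
  calc _ ≤ ∑ j, c * ‖x j‖ := by
        refine norm_sum_le_of_le _ fun j _ => (norm_cross_le _ _).trans ?_
        gcongr
        exact ha j
    _ = c * ∑ j, ‖x j‖ := by rw [Finset.mul_sum]
    _ ≤ c * (N * ‖x‖) := by
        gcongr
        exact sum_norm_le_card_mul_norm x
    _ = _ := by ring

/-- In the linear part `Δt` is discarded using `Δt ≤ 1`, giving a bound free of `T`. In the bilinear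
part it is kept, since smallness is needed there. -/
theorem dynamics_isBounded {B : RobotData} (hB : 0 < B.mass) {Δt D R : ℝ} (h0 : 0 < Δt)
    (h1 : Δt ≤ 1) (hD : T * Δt ≤ D) (hR : 0 ≤ R) {r : Fin T → Fin N → Vec}
    (hr : ∀ i j, ‖r i j‖ ≤ R) :
    (dynamics B Δt r).IsBounded
      (N * (R + (‖B.comInit‖ + D * ‖B.velInit‖ + D * (D + 1) * ‖B.gravity‖)))
      (Δt * (N * (T * Δt ^ 2 * (N / B.mass) * √((T + 1 : ℕ))))) := by
  have hD0 : 0 ≤ D := le_trans (by positivity) hD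
  set M := ‖B.comInit‖ + D * ‖B.velInit‖ + D * (D + 1) * ‖B.gravity‖ with hM
  have hM0 : 0 ≤ M := by positivity
  refine ⟨by positivity, by positivity, fun x => ?_, fun g x => ?_⟩
  · refine norm_consZero_le (by positivity) fun i => ?_
    have h2 : (LinearMap.pi fun i : Fin T => Δt • ∑ j, crossLin (r i j - comFree T B Δt i) ∘ₗ
        forceLin j ∘ₗ blockLin i.castSucc) x i =
        Δt • ∑ j, crossLin (r i j - comFree T B Δt i) (x i.castSucc j) := by
      rw [LinearMap.pi_apply, LinearMap.smul_apply, LinearMap.sum_apply]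
      rfl
    rw [h2, norm_smul, Real.norm_of_nonneg h0.le]
    have h3 := norm_sum_cross_le (a := fun j => r i j - comFree T B Δt i) (c := R + M)
      (by positivity) (fun j => (norm_sub_le _ _).trans
        (add_le_add (hr i j) (norm_comFree_le h0 h1 hD i.2.le))) (x i.castSucc)
    calc _ ≤ 1 * (N * (R + M) * ‖x i.castSucc‖) := by gcongr
      _ = _ := one_mul _
  · refine norm_consZero_le (by positivity) fun i => ?_
    rw [norm_smul, norm_neg, Real.norm_of_nonneg h0.le]
    have h3 := norm_sum_cross_le (a := fun _ => comLin B Δt i g)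
      (c := T * Δt ^ 2 * (N / B.mass) * √((T + 1 : ℕ)) * ‖g‖) (by positivity)
      (fun j => norm_comLin_le hB Δt i.2.le g) (x i.castSucc)
    calc _ ≤ Δt * (N * (T * Δt ^ 2 * (N / B.mass) * √((T + 1 : ℕ)) * ‖g‖) * ‖x i.castSucc‖) := by
          gcongr
      _ = _ := by ring

theorem norm_dynamics_const (B : RobotData) (Δt : ℝ) (r : Fin T → Fin N → Vec) :
    ‖(dynamics B Δt r).const‖ = ‖B.angInit‖ := by
  rw [← sq_eq_sq₀ (norm_nonneg _) (norm_nonneg _), PiLp.norm_sq_eq_of_L2, Fin.sum_univ_succ]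
  simp [dynamics]

/-- The quadratic part of the dynamics is small for small time steps, uniformly in the number of
time steps. -/
theorem quadratic_coeff_le {B : RobotData} (hB : 0 < B.mass) {Δt D : ℝ} (h0 : 0 < Δt)
    (h1 : Δt ≤ 1) (hD : T * Δt ≤ D) :
    Δt * (N * (T * Δt ^ 2 * (N / B.mass) * √((T + 1 : ℕ)))) * √((T + 1 : ℕ)) ≤
      Δt * (D * (D + 1) * (N ^ 2 / B.mass)) := by
  have hD0 : 0 ≤ D := le_trans (by positivity) hD
  have h2 : √((T + 1 : ℕ)) * √((T + 1 : ℕ)) = (T : ℝ) + 1 := by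
    rw [Real.mul_self_sqrt (by positivity)]
    push_cast
    rfl
  -- Two of the three powers of `Δt` pair with `T` and `T + 1` to stay bounded; the third remains as
  -- the small factor.
  calc _ = Δt * ((T * Δt) * Δt * (√((T + 1 : ℕ)) * √((T + 1 : ℕ))) * (N ^ 2 / B.mass)) := by ring
    _ = Δt * ((T * Δt) * (T * Δt + Δt) * (N ^ 2 / B.mass)) := by rw [h2]; ring
    _ ≤ _ := by gcongr

end Locomotion

end

/-! ### Reduction from the extended-real-valued to the real-valued Lagrangian -/

noncomputable section

namespace Locomotion

variable {N T : ℕ} {B : RobotData} {Δt : ℝ} {r : Fin T → Fin N → Vec}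
  {f : Forces N T → ℝ} {φ : Momenta T → ℝ} {X : Fin (T + 1) → Set (Block N)} {ρ : ℝ}

theorem objective_of_mem {x : Forces N T} (z : Momenta T) (hx : ∀ i, x i ∈ X i) :
    objective f φ X x z = ((f x + φ z : ℝ) : EReal) := by
  rw [objective, Finset.sum_eq_zero fun i _ => ?_, add_zero]
  exact if_pos (hx i)

theorem objective_of_notMem {x : Forces N T} (z : Momenta T) (hx : ¬ ∀ i, x i ∈ X i) :
    objective f φ X x z = ⊤ := by
  push Not at hx
  obtain ⟨i, hi⟩ := hx
  have h1 : ∑ j, indicatorFn (X j) (x j) = ⊤ := by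
    refine top_le_iff.1 ?_
    have h2 : indicatorFn (X i) (x i) = ⊤ := if_neg hi
    rw [← h2]
    refine Finset.single_le_sum (f := fun j => indicatorFn (X j) (x j)) (fun j _ => ?_)
      (Finset.mem_univ i)
    unfold indicatorFn
    split_ifs <;> simp
  rw [objective, h1, EReal.coe_add_top]

theorem augLagrangian_of_mem {x : Forces N T} (z w : Momenta T) (hx : ∀ i, x i ∈ X i) :
    augLagrangian B Δt r f φ X ρ x z w = (lag f φ (dynamics B Δt r) ρ x z w : ℝ) := by
  rw [augLagrangian, objective_of_mem z hx, momentumMap_eq, lag, EReal.coe_add (f x + φ z)]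

theorem mem_of_augLagrangian_ne_top {x : Forces N T} {z w : Momenta T}
    (h : augLagrangian B Δt r f φ X ρ x z w ≠ ⊤) (i : Fin (T + 1)) : x i ∈ X i := by
  by_contra hi
  refine h ?_
  rw [augLagrangian, objective_of_notMem z fun hx => hi (hx i), EReal.top_add_coe]

theorem sweep_old (a b : Forces N T) (i : Fin (T + 1)) : sweep a b i (b i) = mix i a b := by
  ext1 l
  rcases lt_trichotomy l i with h | rfl | h
  · simp [mix, sweep, h]
  · simp [mix, sweep]
  · simp [mix, sweep, h.not_gt, h.ne']

theorem sweep_eq (a b : Forces N T) (i : Fin (T + 1)) (u : Block N) :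
    sweep a b i u = mix (i + 1) a b + PiLp.single 2 i (u - a i) := by
  ext1 l
  rcases lt_trichotomy l i with h | rfl | h
  · simp [mix, sweep, h, h.le, h.ne]
  · simp [mix, sweep]
  · simp [mix, sweep, h.not_gt, h.ne', h.not_ge]

theorem sweep_new (a b : Forces N T) (i : Fin (T + 1)) : sweep a b i (a i) = mix (i + 1) a b := by
  rw [sweep_eq, sub_self, ← PiLp.toLp_single, Pi.single_zero, WithLp.toLp_zero, add_zero]

variable {x : ℕ → Forces N T} {z w : ℕ → Momenta T}

/-- Before each block update the point is feasible and the Lagrangian finite. The minimum is then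
below `⊤`, which forces feasibility of the updated point. -/
theorem IsADMM.mem_step
    (H : IsADMM (augLagrangian B Δt r f φ X ρ) (momentumMap B Δt r) ρ x z w) {k : ℕ}
    (hk : ∀ i, x k i ∈ X i) {j : ℕ} (hj : j ≤ T + 1) (i : Fin (T + 1)) :
    mix j (x (k + 1)) (x k) i ∈ X i := by
  induction j generalizing i with
  | zero =>
    rw [mix_zero]
    exact hk i
  | succ j ih =>
    have h1 : augLagrangian B Δt r f φ X ρ
        (sweep (x (k + 1)) (x k) ⟨j, hj⟩ (x (k + 1) ⟨j, hj⟩)) (z k) (w k) ≤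
        augLagrangian B Δt r f φ X ρ
        (sweep (x (k + 1)) (x k) ⟨j, hj⟩ (x k ⟨j, hj⟩)) (z k) (w k) :=
      H.x_step k ⟨j, hj⟩ (mem_univ _)
    rw [sweep_old, sweep_new, augLagrangian_of_mem _ _ (ih (by omega))] at h1
    exact mem_of_augLagrangian_ne_top (ne_top_of_le_ne_top (EReal.coe_ne_top _) h1) i

theorem IsADMM.mem
    (H : IsADMM (augLagrangian B Δt r f φ X ρ) (momentumMap B Δt r) ρ x z w)
    (h0 : ∀ i, x 0 i ∈ X i) (k : ℕ) (i : Fin (T + 1)) : x k i ∈ X i := by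
  induction k generalizing i with
  | zero => exact h0 i
  | succ k ih =>
    have h1 := H.mem_step ih le_rfl i
    rwa [mix_self] at h1

/-- The iterates of the extended-real-valued ADMM are iterates of the real-valued one. -/
theorem IsADMM.isBlockADMM
    (H : IsADMM (augLagrangian B Δt r f φ X ρ) (momentumMap B Δt r) ρ x z w)
    (h0 : ∀ i, x 0 i ∈ X i) : IsBlockADMM f φ (dynamics B Δt r) X ρ x z w where
  mem := H.mem h0
  x_step k i u hu := by
    have h1 : augLagrangian B Δt r f φ X ρ
        (sweep (x (k + 1)) (x k) i (x (k + 1) i)) (z k) (w k) ≤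
        augLagrangian B Δt r f φ X ρ (sweep (x (k + 1)) (x k) i u) (z k) (w k) :=
      H.x_step k i (mem_univ _)
    have h2 := H.mem_step (H.mem h0 k) (Nat.succ_le_of_lt i.2)
    have h3 : ∀ l, sweep (x (k + 1)) (x k) i u l ∈ X l := fun l => by
      by_cases hl : l = i
      · subst hl
        simpa [sweep] using hu
      · have h4 : sweep (x (k + 1)) (x k) i u l = sweep (x (k + 1)) (x k) i (x (k + 1) i) l := by
          simp [sweep, hl]
        rw [h4, sweep_new]
        exact h2 l
    rw [augLagrangian_of_mem _ _ h3, sweep_new, augLagrangian_of_mem _ _ h2,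
      EReal.coe_le_coe_iff, sweep_eq] at h1
    exact h1
  z_step k v := by
    have h1 : augLagrangian B Δt r f φ X ρ (x (k + 1)) (z (k + 1)) (w k) ≤
      augLagrangian B Δt r f φ X ρ (x (k + 1)) v (w k) := H.z_step k (mem_univ _)
    rwa [augLagrangian_of_mem _ _ (H.mem h0 _), augLagrangian_of_mem _ _ (H.mem h0 _),
      EReal.coe_le_coe_iff] at h1
  w_step k := by rw [H.w_step, momentumMap_eq]

theorem isLocalMinimum_of_forall_le {A : Forces N T → Momenta T} {xs : Forces N T}
    (hmem : ∀ i, xs i ∈ X i)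
    (h : ∀ y : Forces N T, (∀ i, y i ∈ X i) → f xs + φ (A xs) ≤ f y + φ (A y)) :
    IsLocalMinimum A f φ X xs (A xs) := by
  refine ⟨hmem, rfl, ?_⟩
  filter_upwards [self_mem_nhdsWithin] with q hq
  rw [objective_of_mem _ hmem]
  by_cases hy : ∀ i, q.1 i ∈ X i
  · rw [objective_of_mem _ hy, EReal.coe_le_coe_iff, show q.2 = A q.1 from hq]
    exact h q.1 hy
  · rw [objective_of_notMem _ hy]
    exact le_top

theorem exists_mapClusterPt_of_bounded {E : Type*} [NormedAddCommGroup E] [ProperSpace E]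
    {u : ℕ → E} {C : ℝ} (h : ∀ k, ‖u (k + 1)‖ ≤ C) : ∃ p, MapClusterPt p atTop u := by
  obtain ⟨p, -, hp⟩ := (isCompact_closedBall (0 : E) C).exists_mapClusterPt_of_frequently
    (l := atTop) (f := u) (Eventually.frequently (by
      filter_upwards [eventually_ge_atTop 1] with k hk
      obtain ⟨l, rfl⟩ := Nat.exists_eq_add_of_le' hk
      simpa using h l))
  exact ⟨p, hp⟩

/-- Using `N + 1` in place of `N` gives one bound serving both dimensions `3 * N * (T + 1)` and `3 *
(T + 1)`, even for `N = 0`. -/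
theorem norm_le_of_sq_le {E : Type*} [NormedAddCommGroup E] {v : E} {K n : ℝ} (N T : ℕ)
    (hn : 0 ≤ n) (hn' : n ≤ 3 * (N + 1) * (T + 1)) (h : ‖v‖ ^ 2 ≤ K * n) :
    ‖v‖ ≤ √(3 * |K| * (N + 1)) * √((T + 1 : ℕ)) := by
  rw [← Real.sqrt_mul (by positivity)]
  refine Real.le_sqrt_of_sq_le (h.trans ?_)
  calc K * n ≤ |K| * (3 * (N + 1) * (T + 1)) := by
        gcongr
        exact le_abs_self K
    _ = _ := by push_cast; ring

instance (T : ℕ) : Nontrivial (Momenta T) :=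
  ⟨⟨WithLp.toLp 2 fun _ => EuclideanSpace.single 0 1, 0, fun h => by
    have h1 := congrArg (fun v : Momenta T => v 0 0) h
    simp at h1⟩⟩

end Locomotion

end

/-! ### Choice of constants and the main theorem -/

theorem mainTheorem4
    (N : ℕ) (B : Locomotion.RobotData) (hmass : 0 < B.mass)
    (Ttot R K μf Lf μφ Lφ ρ : ℝ)
    (hμf : 0 < μf) (hLf : 0 < Lf) (hμφ : 0 < μφ) (hLφ : 0 < Lφ) (hρ : 4 * Lφ ^ 2 / μφ ≤ ρ) :
    ∃ t₀ : ℝ, 0 < t₀ ∧ ∀ T : ℕ, ∃ c₃ : ℝ, 1 < c₃ ∧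
      ∀ Δt : ℝ, 0 < Δt → Δt ≤ t₀ → (T : ℝ) * Δt ≤ Ttot →
      ∀ (r : Fin T → Fin N → Locomotion.Vec)
        (X : Fin (T + 1) → Set (Locomotion.Block N))
        (f : Locomotion.Forces N T → ℝ) (φ : Locomotion.Momenta T → ℝ)
        (xf : Locomotion.Forces N T) (zφ : Locomotion.Momenta T)
        (x : ℕ → Locomotion.Forces N T) (z w : ℕ → Locomotion.Momenta T),
      (∀ i j, ‖r i j‖ ≤ R) →
      (∀ i, Convex ℝ (X i) ∧ IsClosed (X i)) →
      Locomotion.IsSmoothStronglyConvex f μf Lf →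
      Locomotion.IsSmoothStronglyConvex φ μφ Lφ →
      IsMinOn f Set.univ xf → IsMinOn φ Set.univ zφ →
      ‖xf‖ ^ 2 ≤ K * (3 * N * (T + 1)) → ‖zφ‖ ^ 2 ≤ K * (3 * (T + 1)) →
      (∀ i, x 0 i ∈ X i) → ‖x 0‖ ^ 2 ≤ K * (3 * N * (T + 1)) →
      ‖z 0‖ ^ 2 ≤ K * (3 * (T + 1)) → ‖w 0‖ ^ 2 ≤ K * (3 * (T + 1)) →
      Locomotion.IsADMM (Locomotion.augLagrangian B Δt r f φ X ρ)
        (Locomotion.momentumMap B Δt r) ρ x z w →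
      (∀ k, Locomotion.augLagrangian B Δt r f φ X ρ (x k) (z k) (w k) ≠ ⊤) ∧
      (∃ p, MapClusterPt p Filter.atTop (fun k => (x k, z k, w k))) ∧
      ∀ (xs : Locomotion.Forces N T) (zs ws : Locomotion.Momenta T),
        MapClusterPt (xs, zs, ws) Filter.atTop (fun k => (x k, z k, w k)) →
        Locomotion.TwiceDifferentiableAt
          (fun q : Locomotion.Forces N T × Locomotion.Momenta T × Locomotion.Momenta T =>
            Locomotion.augLagrangian B Δt r f φ X ρ q.1 q.2.1 q.2.2) (xs, zs, ws) →
        Filter.Tendsto (fun k => (x k, z k, w k)) Filter.atTop (nhds (xs, zs, ws)) ∧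
        (fun k : ℕ =>
          (Locomotion.augLagrangian B Δt r f φ X ρ (x k) (z k) (w k)).toReal -
            (Locomotion.augLagrangian B Δt r f φ X ρ xs zs ws).toReal)
          =O[Filter.atTop] (fun k : ℕ => (c₃⁻¹) ^ k) ∧
        Locomotion.IsLocalMinimum (Locomotion.momentumMap B Δt r) f φ X xs zs := by
  open Locomotion in
  have hρ0 : 0 < ρ := lt_of_lt_of_le (by positivity) hρ
  obtain ⟨κ, hκdef⟩ : ∃ κ, κ = √(3 * |K| * (N + 1)) := ⟨_, rfl⟩
  have hκ : 0 ≤ κ := by rw [hκdef]; positivity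
  obtain ⟨m, hmdef⟩ : ∃ m, m = N * (|R| + (‖B.comInit‖ + |Ttot| * ‖B.velInit‖ +
    |Ttot| * (|Ttot| + 1) * ‖B.gravity‖)) := ⟨_, rfl⟩
  have hm : 0 ≤ m := by rw [hmdef]; positivity
  obtain ⟨C, hC, hbound⟩ := exists_iterate_bound hμf hLf hμφ hLφ hρ hκ hm (norm_nonneg B.angInit)
  obtain ⟨Γ, hΓdef⟩ : ∃ Γ, Γ = |Ttot| * (|Ttot| + 1) * ((N : ℝ) ^ 2 / B.mass) := ⟨_, rfl⟩
  have hΓ : 0 ≤ Γ := by rw [hΓdef]; positivity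
  -- The three thresholds ensure `Δt ≤ 1`, `q * S ≤ 1` and `q * (C * S) ≤ μf / 4`. None involves
  -- `T`, since `C` and `Γ` do not.
  refine ⟨min 1 (min (1 / (Γ + 1)) (μf / 4 / (C * (Γ + 1)))), by positivity, fun T => ?_⟩
  obtain ⟨S, hSdef⟩ : ∃ S, S = √((T + 1 : ℕ)) := ⟨_, rfl⟩
  have hS : 1 ≤ S := by
    rw [hSdef, Real.one_le_sqrt]
    exact_mod_cast Nat.le_add_left 1 T
  have hS0 : 0 < S := by linarith
  -- The constant of `IsBlockADMM.lag_le_value_add` with `n = T + 1` and radius `C * S`; through it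
  -- the rate depends on `T`.
  obtain ⟨D, hD⟩ : ∃ D, D = 2 * ((T + 1 : ℕ) : ℝ) ^ 2 *
    ((Lf + 2 * (C * S) + ρ * (m + 6 * (C * S)) ^ 2) ^ 2 + (ρ * (m + 6 * (C * S))) ^ 2) / μf +
        ρ⁻¹ * Lφ ^ 2 := ⟨_, rfl⟩
  have hD0 : 0 < D := by rw [hD]; positivity
  obtain ⟨c, hc⟩ : ∃ c, c = min (μf / 2) (μφ / 4) := ⟨_, rfl⟩
  have hc0 : 0 < c := by rw [hc]; positivity
  obtain ⟨θ, hθ⟩ : ∃ θ, θ = D / c := ⟨_, rfl⟩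
  have hθ0 : 0 < θ := by rw [hθ]; positivity
  have hθc : θ * c = D := by rw [hθ, div_mul_cancel₀ _ hc0.ne']
  -- The inverse of the contraction factor `θ / (1 + θ)`.
  refine ⟨(1 + θ) / θ, by rw [one_lt_div hθ0]; linarith, ?_⟩
  intro Δt hΔ hΔt hTtot r X f φ xf zφ x z w hr hX hf hφ hxf hzφ bxf bzφ hx0 bx bz bw hADMM
  have hT' : T * Δt ≤ |Ttot| := hTtot.trans (le_abs_self _)
  have hΔ1 : Δt ≤ 1 := hΔt.trans (min_le_left _ _)
  have hA := dynamics_isBounded hmass hΔ hΔ1 hT' (abs_nonneg R)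
    (fun i j => (hr i j).trans (le_abs_self R))
  have hqS := quadratic_coeff_le (N := N) hmass hΔ hΔ1 hT'
  rw [← hmdef] at hA
  rw [← hΓdef] at hqS
  rw [← hSdef] at hA hqS
  obtain ⟨q, hq⟩ : ∃ q, q = Δt * (N * (T * Δt ^ 2 * (N / B.mass) * S)) := ⟨_, rfl⟩
  rw [← hq] at hA hqS
  have hΔΓ : Δt * Γ ≤ Δt * (Γ + 1) := by gcongr; linarith
  have hqS1 : q * S ≤ 1 := by
    refine hqS.trans (hΔΓ.trans ?_)
    rw [← le_div_iff₀ (by positivity)]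
    exact hΔt.trans ((min_le_right _ _).trans (min_le_left _ _))
  have hqCS : q * (C * S) ≤ μf / 4 := by
    have h1 : Δt * (C * (Γ + 1)) ≤ μf / 4 := by
      rw [← le_div_iff₀ (by positivity)]
      exact hΔt.trans ((min_le_right _ _).trans (min_le_right _ _))
    calc q * (C * S) = C * (q * S) := by ring
      _ ≤ C * (Δt * (Γ + 1)) := mul_le_mul_of_nonneg_left (hqS.trans hΔΓ) hC.le
      _ = Δt * (C * (Γ + 1)) := by ring
      _ ≤ μf / 4 := h1
  have hq1 : q ≤ 1 := (le_mul_of_one_le_right hA.bil_nonneg hS).trans hqS1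
  have H := hADMM.isBlockADMM hx0
  have hNx : (3 * N * (T + 1) : ℝ) ≤ 3 * (N + 1) * (T + 1) := by gcongr; linarith
  have hNz : (3 * (T + 1) : ℝ) ≤ 3 * (N + 1) * (T + 1) := by
    have h1 : (0 : ℝ) ≤ 3 * N * (T + 1) := by positivity
    linarith
  have hbd := hbound (T + 1) (Block N) (Momenta T) f φ (dynamics B Δt r) X x z w xf zφ q S H
    (fun i => (hX i).1) hf hφ hxf hzφ hA (norm_dynamics_const B Δt r).le hS hqS1
  rw [hκdef, hSdef] at hbd
  specialize hbd (norm_le_of_sq_le N T (by positivity) hNx bxf)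
    (norm_le_of_sq_le N T (by positivity) hNz bzφ) (norm_le_of_sq_le N T (by positivity) hNx bx)
    (norm_le_of_sq_le N T (by positivity) hNz bz) (norm_le_of_sq_le N T (by positivity) hNz bw)
  rw [← hSdef] at hbd
  refine ⟨fun k => ?_, exists_mapClusterPt_of_bounded (C := C * S) fun k => ?_,
    fun xs zs ws hp _ => ?_⟩
  · rw [augLagrangian_of_mem _ _ (H.mem k)]
    exact EReal.coe_ne_top _
  · exact norm_prod_le_iff.2 ⟨(hbd k).1, norm_prod_le_iff.2 (hbd k).2⟩
  have hdesc : ∀ k, lag f φ (dynamics B Δt r) ρ (x (k + 2)) (z (k + 2)) (w (k + 2)) +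
      c * (‖x (k + 2) - x (k + 1)‖ ^ 2 + ‖z (k + 2) - z (k + 1)‖ ^ 2) ≤
      lag f φ (dynamics B Δt r) ρ (x (k + 1)) (z (k + 1)) (w (k + 1)) := fun k => by
    have h1 := H.descent (fun i => (hX i).1) hμf.le hμφ hLφ hρ hf hφ k
    have h2 : c * ‖x (k + 2) - x (k + 1)‖ ^ 2 ≤ μf / 2 * ‖x (k + 2) - x (k + 1)‖ ^ 2 := by
      gcongr
      exact hc.trans_le (min_le_left _ _)
    have h3 : c * ‖z (k + 2) - z (k + 1)‖ ^ 2 ≤ μφ / 4 * ‖z (k + 2) - z (k + 1)‖ ^ 2 := by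
      gcongr
      exact hc.trans_le (min_le_right _ _)
    linarith
  have hval : ∀ y : Forces N T, (∀ i, y i ∈ X i) → ∀ k,
      lag f φ (dynamics B Δt r) ρ (x (k + 2)) (z (k + 2)) (w (k + 2)) ≤
      f y + φ ((dynamics B Δt r).eval y) + θ * c *
      (‖x (k + 2) - x (k + 1)‖ ^ 2 + ‖z (k + 2) - z (k + 1)‖ ^ 2) := fun y hy k => by
    rw [hθc, hD]
    exact H.lag_le_value_add (fun i => (hX i).1) hμf hLf.le hμφ.le hρ0 hf hφ hA hq1
      (by positivity) hqCS (fun k => (hbd k).1) (fun k => (hbd k).2.2) hy k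
  obtain ⟨hlim, hge, ⟨M, hM⟩, hmem, hzs, hmin⟩ := H.linear_convergence (fun i => (hX i).2) hμφ.le
    hρ0 hf hφ hA hc0 hθ0 hdesc hval hp
  refine ⟨hlim, ?_, ?_⟩
  · refine Asymptotics.IsBigO.of_bound (M * ((1 + θ) / θ)) ?_
    filter_upwards [Filter.eventually_ge_atTop 1] with k hk
    obtain ⟨l, rfl⟩ := Nat.exists_eq_add_of_le' hk
    rw [augLagrangian_of_mem _ _ (H.mem _), augLagrangian_of_mem _ _ hmem, EReal.toReal_coe,
      EReal.toReal_coe, Real.norm_of_nonneg (sub_nonneg.2 (hge l)), inv_div,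
      Real.norm_of_nonneg (by positivity)]
    refine (hM l).trans (le_of_eq ?_)
    rw [pow_succ]
    field_simp
  · rw [hzs, ← momentumMap_eq]
    refine isLocalMinimum_of_forall_le hmem fun y hy => ?_
    rw [momentumMap_eq, momentumMap_eq]
    exact hmin y hy
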